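/- Let $0<s<1$, $m>0$, $2^*_s=6/(3-2s)$, and let $A:\mathbb R^3\to\mathbb R^3$ have locally bounded gradient (i.e. $A$ is locally Lipschitz) and satisfy \[ g(x-y)\cdot A\Big(g\,\frac{x+y}{2}\Big)=(x-y)\cdot A\Big(\frac{x+y}{2}\Big)\qquad\text{for all }x,y\in\mathbb R^3,\ g\in O(3). \] Let $\mathcal K_\nu(\zeta)=\frac12(\frac\zeta2)^\nu\int_0^{\infty}e^{-\zeta^2/(4t)-t}\,t^{-1-\nu}\,dt$ ($\zeta>0$) be the modified Bessel function of the third kind and $C_s=\dfrac{s\,2^{(2s-1)/2}}{\pi^{3/2}\,\Gamma(1-s)}$. For measurable $u,v:\mathbb R^3\to\mathbb C$ (identified when equal almost everywhere) put $D_Au(x,y)=e^{-i(x-y)\cdot A(\frac{x+y}{2})}u(x)-u(y)$ and \[ (u,v)_{A,s}=\frac{C_s}{2}\,m^{\frac{3+2s}{2}}\,\Re\int_{\mathbb R^3\times\mathbb R^3}\frac{D_Au(x,y)\,\overline{D_Av(x,y)}}{|x-y|^{\frac{3+2s}{2}}}\,\mathcal K_{\frac{3+2s}{2}}(m|x-y|)\,dx\,dy+m^{2s}\,\Re\int_{\mathbb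 R^3}u\,\overline v\,dx,\qquad \|u\|_{A,s}^2=(u,u)_{A,s}. \] Let $H^s_A(\mathbb R^3,\mathbb C)$ be the closure of $C_c^\infty(\mathbb R^3,\mathbb C)$ in the space of all $u$ with $\|u\|_{A,s}<\infty$, and let $H^s_{A,\mathrm{rad}}(\mathbb R^3,\mathbb C)$ be the set of its radially symmetric ($O(3)$-invariant) elements. A function $u\in H^s_A(\mathbb R^3,\mathbb C)$ is a weak solution of \[ (-\Delta+m^2)^s_A u=|u|^{p-2}u\quad\text{in }\mathbb R^3 \tag{1} \] if, for every $v\in H^s_A(\mathbb R^3,\mathbb C)$, the function $|u|^{p-2}u\,\overline v$ is integrable and $(u,v)_{A,s}=\Re\int_{\mathbb R^3}|u|^{p-2}u\,\overline v\,dx$. Then, for every $p\in(2,2^*_s)$, the infimum \[ \mathcal M_{A,\mathrm{rad}}=\inf\big\{\|v\|_{A,s}^2 : v\in H^s_{A,\mathrm{rad}}(\mathbb R^3,\mathbb C),\ \|v\|_{L^p(\mathbb R^3,\mathbb C)}=1\big\} \] is positive and attained at some $w$ in this set such that $u=\mathcal M_{A,\mathrm{rad}}^{1/(p-2)}\,w\in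 H^s_{A,\mathrm{rad}}(\mathbb R^3,\mathbb C)$ is a nontrivial weak solution of (1). -/

import Mathlib

open MeasureTheory Set
open scoped ComplexConjugate ContDiff

noncomputable section

/-- Euclidean three-space. -/
abbrev E3 : Type := EuclideanSpace ℝ (Fin 3)

/-- The modified Bessel function `K_ν(ζ)`, `ζ > 0`, of the third kind (Macdonald function),
`K_ν(ζ) = (1/2) (ζ/2)^ν ∫₀^∞ exp(-ζ²/(4t) - t) t^(-1-ν) dt`. -/
def besselKFun (ν ζ : ℝ) : ℝ :=
  (1 / 2) * (ζ / 2) ^ ν *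
    ∫ t in Ioi (0 : ℝ), Real.exp (-ζ ^ 2 / (4 * t) - t) * t ^ (-1 - ν)

/-- The constant `C_s = s 2^((2s-1)/2) / (π^(3/2) Γ(1-s))`. -/
def pseudorelConst (s : ℝ) : ℝ :=
  s * (2 : ℝ) ^ ((2 * s - 1) / 2) / (Real.pi ^ ((3 : ℝ) / 2) * Real.Gamma (1 - s))

/-- The kernel `z ↦ K_{(3+2s)/2}(m|z|) / |z|^((3+2s)/2)`. -/
def pseudorelKernel (s m : ℝ) (z : E3) : ℝ :=
  besselKFun ((3 + 2 * s) / 2) (m * ‖z‖) / ‖z‖ ^ ((3 + 2 * s) / 2)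

/-- The magnetic difference `exp(-i (x-y) · A((x+y)/2)) u(x) - u(y)`. -/
def magDiff (A : E3 → E3) (u : E3 → ℂ) (x y : E3) : ℂ :=
  Complex.exp (-Complex.I * ((inner ℝ (x - y) (A ((2 : ℝ)⁻¹ • (x + y))) : ℝ) : ℂ)) * u x - u y

/-- The integrand of `⟨u, v⟩_{A,s}`, on pairs of points. -/
def gagliardoIntegrand (A : E3 → E3) (s m : ℝ) (u v : E3 → ℂ) (q : E3 × E3) : ℂ :=
  magDiff A u q.1 q.2 * conj (magDiff A v q.1 q.2) * (pseudorelKernel s m (q.1 - q.2) : ℂ)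

/-- The real scalar product
`(u, v)_{A,s} = (C_s/2) m^((3+2s)/2) ⟨u, v⟩_{A,s} + m^(2s) (u, v)_{L²}`. -/
def magInner (A : E3 → E3) (s m : ℝ) (u v : E3 → ℂ) : ℝ :=
  pseudorelConst s / 2 * m ^ ((3 + 2 * s) / 2) * (∫ q, gagliardoIntegrand A s m u v q).re
    + m ^ (2 * s) * (∫ x, u x * conj (v x)).re

/-- The squared norm `‖u‖²_{A,s} = (u, u)_{A,s}`. -/
def magNormSq (A : E3 → E3) (s m : ℝ) (u : E3 → ℂ) : ℝ :=
  magInner A s m u u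

/-- The space `ℋ` of all `u` with `(u, u)_{A,s} < ∞`: `u ∈ L²` and the nonnegative integrand
of `⟨u, u⟩_{A,s}` has finite integral. -/
def MemMagH (A : E3 → E3) (s m : ℝ) (u : E3 → ℂ) : Prop :=
  MemLp u 2 volume ∧ Integrable (gagliardoIntegrand A s m u u) volume

/-- The pseudorelativistic fractional magnetic Sobolev space `H^s_A(ℝ³, ℂ)`: the closure of
`C_c^∞(ℝ³, ℂ)` in `ℋ`. -/
def MemHsA (A : E3 → E3) (s m : ℝ) (u : E3 → ℂ) : Prop :=
  MemMagH A s m u ∧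
    ∀ ε : ℝ, 0 < ε → ∃ φ : E3 → ℂ, ContDiff ℝ ∞ φ ∧ HasCompactSupport φ ∧
      MemMagH A s m (fun x => u x - φ x) ∧ magNormSq A s m (fun x => u x - φ x) < ε

/-- Radial symmetry of (the a.e. class of) `u`: invariance under `O(3)`. -/
def IsRadialAE (u : E3 → ℂ) : Prop :=
  ∀ g : E3 ≃ₗᵢ[ℝ] E3, (fun x => u (g x)) =ᵐ[volume] u

/-- The radial subspace `H^s_{A,rad}(ℝ³, ℂ)`. -/
def MemHsARad (A : E3 → E3) (s m : ℝ) (u : E3 → ℂ) : Prop :=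
  MemHsA A s m u ∧ IsRadialAE u

/-- The `O(3)`-invariance condition on the magnetic potential. -/
def MagIsometryCondition (A : E3 → E3) : Prop :=
  ∀ (x y : E3) (g : E3 ≃ₗᵢ[ℝ] E3),
    inner ℝ (g (x - y)) (A (g ((2 : ℝ)⁻¹ • (x + y))))
      = inner ℝ (x - y) (A ((2 : ℝ)⁻¹ • (x + y)))

/-- `u` is a weak solution of `(-Δ + m²)_A^s u = f` in `ℝ³`: `u ∈ H^s_A` and, for every
`v ∈ H^s_A`, the pairing of `f` with `v` converges and `(u, v)_{A,s} = Re ∫ f v̄`. (The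
functional `v ↦ Re ∫ f v̄` is then bounded on `H^s_A`, being equal to `(u, ·)_{A,s}`.) -/
def IsMagWeakSolution (A : E3 → E3) (s m : ℝ) (f u : E3 → ℂ) : Prop :=
  MemHsA A s m u ∧
    ∀ v : E3 → ℂ, MemHsA A s m v →
      Integrable (fun x => f x * conj (v x)) volume ∧
        magInner A s m u v = (∫ x, f x * conj (v x)).re

/-- The power nonlinearity `|u|^(p-2) u`. -/
def powerNonlin (p : ℝ) (u : E3 → ℂ) : E3 → ℂ :=
  fun x => ((‖u x‖ ^ (p - 2) : ℝ) : ℂ) * u x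

/-- The radial `L^p` unit sphere `𝒮_rad = {u ∈ H^s_{A,rad} : ‖u‖_{L^p} = 1}`. -/
def radialSphere (A : E3 → E3) (s m p : ℝ) : Set (E3 → ℂ) :=
  {u | MemHsARad A s m u ∧ eLpNorm u (ENNReal.ofReal p) volume = 1}

/-- `ℳ_{A,rad} = inf {‖u‖²_{A,s} : u ∈ 𝒮_rad}`. -/
def radialInf (A : E3 → E3) (s m p : ℝ) : ℝ :=
  sInf (magNormSq A s m '' radialSphere A s m p)

end

noncomputable section

open Filter Topology

/-! This is the direct method combined with symmetric criticality; compactness comes from radial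
symmetry.

Up to constants the kernel is at most `|z|^(-(3+2s))`, and it is bounded below by a multiple of this
for `|z| ≤ 2`. Since the phase has modulus one, `|u(y)| ≤ |u(z)| + |D_A u(y,z)|`. Telescoping
averages of `|u|` over dyadic balls around `x` then gives the pointwise inequality `|u(x)|^p ≤ C
M^(p-2) e(x)`, where `e` is the energy density and `M²` bounds the energy in the unit ball at `x`
(`exists_enorm_rpow_le`). Its integral is the Sobolev inequality up to the critical exponent. A
radial function of bounded energy has little energy in any unit ball far from the origin, because
many disjoint rotated copies of that ball carry the same amount. So `M` is small there, and `L^p`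
tails are uniformly small (`exists_radius_lintegral_rpow_le`).

Locally, averaging `u` against the magnetic phase gives an operator that turns weak convergence into
pointwise convergence and differs from `u` by a small multiple of the energy
(`tendsto_lintegral_ball_of_weak`). Interpolation with the critical exponent makes the radial
embedding into `L^p` compact, so a weak limit of a minimizing sequence keeps `L^p` norm one and is a
minimizer. It is nonzero, hence the infimum is positive.

All of this takes place in the Hilbert space `MagSpace`, where `u` becomes `(√weight · D_A u, m^s
u)`. Convexity of `|·|^p` gives the Euler-Lagrange equation against radial functions. The Riesz
representative `X` of `v ↦ ∫ conj(|w|^(p-2) w) v` is itself radial, by `O(3)`-invariance and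
uniqueness. Testing with `W - I X`, where `W` represents the minimizer and `I` is the infimum,
therefore gives `W = I X`, which is the equation against every test function. Scaling absorbs the
multiplier `I`. -/

variable {A : E3 → E3} {s m p : ℝ} {u v w : E3 → ℂ}

/-! ### The Bessel kernel and its comparison with `|z|^(-(3+2s))` -/

/-- The profile `∫₀^∞ exp(-1/(4r) - a r) r^(-1-ν) dr`, in terms of which
`K_ν(ζ) = (1/2) 2^(-ν) ζ^(-ν) besselProfile ν (ζ²)`. -/
def besselProfile (ν a : ℝ) : ℝ :=
  ∫ r in Ioi (0 : ℝ), Real.exp (-1 / (4 * r) - a * r) * r ^ (-1 - ν)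

lemma integrableOn_besselProfile_zero {ν : ℝ} (hν : 0 < ν) :
    IntegrableOn (fun r : ℝ => Real.exp (-1 / (4 * r)) * r ^ (-1 - ν)) (Ioi 0) := by
  have h1 : IntegrableOn (fun y : ℝ => Real.exp (-(1 / 4) * y) * y ^ (ν - 1)) (Ioi 0) := by
    have := integrableOn_rpow_mul_exp_neg_mul_rpow (p := 1) (s := ν - 1) (b := 1 / 4)
      (by linarith) one_pos (by norm_num)
    refine this.congr_fun (fun x _ => ?_) measurableSet_Ioi
    simp only [Real.rpow_one]; ring
  have h2 := (integrableOn_Ioi_comp_rpow_iff' _ (p := -1) (by norm_num)).2 h1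
  refine h2.congr_fun (fun x hx => ?_) measurableSet_Ioi
  have hx : 0 < x := hx
  have h3 : x ^ (-1 - ν) = x ^ ((-1 : ℝ) - 1) * (x ^ (-1 : ℝ)) ^ (ν - 1) := by
    rw [← Real.rpow_mul hx.le, ← Real.rpow_add hx]; congr 1; ring
  simp only [smul_eq_mul]
  rw [h3, Real.rpow_neg_one]
  have : -1 / (4 * x) = -(1 / 4) * x⁻¹ := by field_simp
  rw [this]; ring

lemma integrableOn_besselProfile {ν a : ℝ} (hν : 0 < ν) (ha : 0 ≤ a) :
    IntegrableOn (fun r : ℝ => Real.exp (-1 / (4 * r) - a * r) * r ^ (-1 - ν)) (Ioi 0) := by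
  refine (integrableOn_besselProfile_zero hν).mono' ?_ ?_
  · exact (by fun_prop : Measurable
      (fun r : ℝ => Real.exp (-1 / (4 * r) - a * r) * r ^ (-1 - ν))).aestronglyMeasurable
  · filter_upwards [ae_restrict_mem measurableSet_Ioi] with r hr
    have hr : 0 < r := hr
    rw [Real.norm_of_nonneg (by positivity)]
    gcongr
    have := mul_nonneg ha hr.le
    linarith

lemma besselProfile_anti {ν a b : ℝ} (hν : 0 < ν) (ha : 0 ≤ a) (hab : a ≤ b) :
    besselProfile ν b ≤ besselProfile ν a := by
  refine setIntegral_mono_on (integrableOn_besselProfile hν (ha.trans hab))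
    (integrableOn_besselProfile hν ha) measurableSet_Ioi fun r hr => ?_
  have hr : 0 < r := hr
  gcongr

lemma besselProfile_pos {ν a : ℝ} (hν : 0 < ν) (ha : 0 ≤ a) : 0 < besselProfile ν a := by
  rw [besselProfile, setIntegral_pos_iff_support_of_nonneg_ae _ (integrableOn_besselProfile hν ha)]
  · have : (Function.support fun r : ℝ => Real.exp (-1 / (4 * r) - a * r) * r ^ (-1 - ν)) ∩ Ioi 0
        = Ioi 0 := by
      refine inter_eq_right.2 fun r hr => ?_
      have hr : 0 < r := hr
      simp only [Function.mem_support]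
      positivity
    rw [this]; simp
  · filter_upwards [ae_restrict_mem measurableSet_Ioi] with r hr
    have hr : 0 < r := hr
    simp only [Pi.zero_apply]
    positivity

/-- The substitution `t = ζ² r` separates the singular power `ζ^(-ν)` from a positive factor that is
nonincreasing in `ζ` and finite at `0`. Both kernel bounds follow from monotonicity of that factor.
-/
lemma besselKFun_eq {ν ζ : ℝ} (hζ : 0 < ζ) :
    besselKFun ν ζ = (1 / 2) * 2 ^ (-ν) * ζ ^ (-ν) * besselProfile ν (ζ ^ 2) := by
  have hb : (0 : ℝ) < ζ ^ 2 := by positivity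
  have h := integral_comp_mul_left_Ioi
    (fun t => Real.exp (-ζ ^ 2 / (4 * t) - t) * t ^ (-1 - ν)) 0 hb
  rw [mul_zero, smul_eq_mul, eq_inv_mul_iff_mul_eq₀ hb.ne'] at h
  rw [besselKFun, ← h]
  have h2 : ∫ x in Ioi (0 : ℝ), Real.exp (-ζ ^ 2 / (4 * (ζ ^ 2 * x)) - ζ ^ 2 * x)
        * (ζ ^ 2 * x) ^ (-1 - ν)
      = (ζ ^ 2) ^ (-1 - ν) * besselProfile ν (ζ ^ 2) := by
    rw [besselProfile, ← integral_const_mul]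
    refine setIntegral_congr_fun measurableSet_Ioi fun r hr => ?_
    have hr : 0 < r := hr
    rw [Real.mul_rpow hb.le hr.le]
    have : -ζ ^ 2 / (4 * (ζ ^ 2 * r)) = -1 / (4 * r) := by field_simp
    rw [this]; ring
  rw [h2]
  have h3 : ζ ^ 2 = ζ ^ (2 : ℝ) := by norm_cast
  have h4 : (ζ / 2) ^ ν * (ζ ^ 2 * (ζ ^ 2) ^ (-1 - ν)) = 2 ^ (-ν) * ζ ^ (-ν) := by
    rw [Real.div_rpow hζ.le (by norm_num), Real.rpow_neg (by norm_num : (0 : ℝ) ≤ 2), h3,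
      ← Real.rpow_mul hζ.le, ← Real.rpow_add hζ, div_eq_mul_inv, mul_right_comm,
      ← Real.rpow_add hζ, mul_comm]
    congr 2; ring
  linear_combination (1 / 2) * besselProfile ν (ζ ^ 2) * h4

lemma pseudorelKernel_eq {s m : ℝ} (hm : 0 < m) {z : E3} (hz : z ≠ 0) :
    pseudorelKernel s m z = (1 / 2) * 2 ^ (-((3 + 2 * s) / 2)) * m ^ (-((3 + 2 * s) / 2)) *
      ‖z‖ ^ (-(3 + 2 * s)) * besselProfile ((3 + 2 * s) / 2) ((m * ‖z‖) ^ 2) := by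
  have hz' : 0 < ‖z‖ := norm_pos_iff.2 hz
  rw [pseudorelKernel, besselKFun_eq (by positivity), Real.mul_rpow hm.le hz'.le, div_eq_mul_inv,
    ← Real.rpow_neg hz'.le]
  have : ‖z‖ ^ (-(3 + 2 * s)) = ‖z‖ ^ (-((3 + 2 * s) / 2)) * ‖z‖ ^ (-((3 + 2 * s) / 2)) := by
    rw [← Real.rpow_add hz']; congr 1; ring
  rw [this]; ring

/-- Division by zero yields `0`, so the kernel vanishes on the diagonal. Estimates stated for all
points need this value. -/
lemma pseudorelKernel_zero {s m : ℝ} (hs : 0 < s) : pseudorelKernel s m 0 = 0 := by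
  rw [pseudorelKernel, norm_zero, Real.zero_rpow (by positivity), div_zero]

lemma pseudorelKernel_pos {s m : ℝ} (hs : 0 < s) (hm : 0 < m) {z : E3} (hz : z ≠ 0) :
    0 < pseudorelKernel s m z := by
  have hz' : 0 < ‖z‖ := norm_pos_iff.2 hz
  rw [pseudorelKernel_eq hm hz]
  have := besselProfile_pos (ν := (3 + 2 * s) / 2) (by positivity) (sq_nonneg (m * ‖z‖))
  positivity

lemma pseudorelKernel_nonneg {s m : ℝ} (hs : 0 < s) (hm : 0 < m) (z : E3) :
    0 ≤ pseudorelKernel s m z := by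
  rcases eq_or_ne z 0 with rfl | hz
  · exact (pseudorelKernel_zero hs).ge
  · exact (pseudorelKernel_pos hs hm hz).le

lemma pseudorelKernel_map {s m : ℝ} (g : E3 ≃ₗᵢ[ℝ] E3) (z : E3) :
    pseudorelKernel s m (g z) = pseudorelKernel s m z := by
  simp [pseudorelKernel]

lemma measurable_besselKFun (ν : ℝ) : Measurable (besselKFun ν) := by
  unfold besselKFun
  refine Measurable.mul (by fun_prop) ?_
  have h : Measurable (fun q : ℝ × ℝ =>
      Real.exp (-q.1 ^ 2 / (4 * q.2) - q.2) * q.2 ^ (-1 - ν)) := by fun_prop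
  exact (h.stronglyMeasurable.integral_prod_right
    (ν := volume.restrict (Ioi (0 : ℝ)))).measurable

lemma measurable_pseudorelKernel (s m : ℝ) : Measurable (pseudorelKernel s m) := by
  unfold pseudorelKernel
  exact ((measurable_besselKFun _).comp (by fun_prop)).div (by fun_prop)

/-- The kernel decays exponentially, so a lower bound can only be local. The radius `2` suffices
because two points of a ball of radius at most `1` are at distance less than `2`. -/
lemma exists_pseudorelKernel_ge {s m : ℝ} (hs : 0 < s) (hm : 0 < m) :
    ∃ c : ℝ, 0 < c ∧ ∀ z : E3, z ≠ 0 → ‖z‖ ≤ 2 →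
      c ≤ ‖z‖ ^ (3 + 2 * s) * pseudorelKernel s m z := by
  have hν : 0 < (3 + 2 * s) / 2 := by positivity
  refine ⟨(1 / 2) * 2 ^ (-((3 + 2 * s) / 2)) * m ^ (-((3 + 2 * s) / 2)) *
    besselProfile ((3 + 2 * s) / 2) ((m * 2) ^ 2), ?_, fun z hz h2 => ?_⟩
  · have := besselProfile_pos hν (sq_nonneg (m * 2))
    positivity
  · have hz' : 0 < ‖z‖ := norm_pos_iff.2 hz
    rw [pseudorelKernel_eq hm hz, Real.rpow_neg hz'.le]
    have hp : ‖z‖ ^ (3 + 2 * s) ≠ 0 := by positivity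
    have h3 : besselProfile ((3 + 2 * s) / 2) ((m * 2) ^ 2)
        ≤ besselProfile ((3 + 2 * s) / 2) ((m * ‖z‖) ^ 2) :=
      besselProfile_anti hν (sq_nonneg _) (by gcongr)
    calc _ ≤ (1 / 2) * 2 ^ (-((3 + 2 * s) / 2)) * m ^ (-((3 + 2 * s) / 2)) *
        besselProfile ((3 + 2 * s) / 2) ((m * ‖z‖) ^ 2) := by gcongr
      _ = _ := by field_simp

lemma exists_pseudorelKernel_le {s m : ℝ} (hs : 0 < s) (hm : 0 < m) :
    ∃ C : ℝ, 0 < C ∧ ∀ z : E3, pseudorelKernel s m z ≤ C * ‖z‖ ^ (-(3 + 2 * s)) := by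
  have hν : 0 < (3 + 2 * s) / 2 := by positivity
  refine ⟨(1 / 2) * 2 ^ (-((3 + 2 * s) / 2)) * m ^ (-((3 + 2 * s) / 2)) *
    besselProfile ((3 + 2 * s) / 2) 0, ?_, fun z => ?_⟩
  · have := besselProfile_pos hν le_rfl
    positivity
  · have hpos := besselProfile_pos hν le_rfl
    rcases eq_or_ne z 0 with rfl | hz
    · rw [pseudorelKernel_zero hs]; positivity
    rw [pseudorelKernel_eq hm hz, mul_right_comm _ (‖z‖ ^ (-(3 + 2 * s)))]
    gcongr
    exact besselProfile_anti hν le_rfl (sq_nonneg _)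

/-! ### Energy density and averages over balls -/

/-- The density `y ↦ ∫ |D_A u(y, z)|² k(y - z) dz` of the Gagliardo energy. -/
def magDensity (A : E3 → E3) (s m : ℝ) (u : E3 → ℂ) (y : E3) : ENNReal :=
  ∫⁻ z, ‖magDiff A u y z‖ₑ ^ 2 * ENNReal.ofReal (pseudorelKernel s m (y - z))

/-- The full energy density `|u|² + ∫ |D_A u(·, z)|² k(· - z) dz`. -/
def energyDensity (A : E3 → E3) (s m : ℝ) (u : E3 → ℂ) (y : E3) : ENNReal :=
  ‖u y‖ₑ ^ 2 + magDensity A s m u y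

lemma norm_magPhase (θ : ℝ) : ‖Complex.exp (-Complex.I * (θ : ℂ))‖ = 1 := by
  rw [Complex.norm_exp]; simp

lemma magDiff_self (x : E3) : magDiff A u x x = 0 := by simp [magDiff]

/-- Diamagnetic triangle inequality: the phase has modulus one, so moduli can be compared as in the
nonmagnetic case. -/
lemma enorm_le_enorm_add_magDiff (y z : E3) : ‖u y‖ₑ ≤ ‖u z‖ₑ + ‖magDiff A u y z‖ₑ := by
  have h : ‖u y‖ ≤ ‖u z‖ + ‖magDiff A u y z‖ := by
    have h1 : Complex.exp (-Complex.I * ((inner ℝ (y - z) (A ((2 : ℝ)⁻¹ • (y + z))) : ℝ) : ℂ)) * u y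
        = u z + magDiff A u y z := by rw [magDiff]; ring
    have h2 := norm_add_le (u z) (magDiff A u y z)
    rwa [← h1, norm_mul, norm_magPhase, one_mul] at h2
  simp only [← ofReal_norm]
  rw [← ENNReal.ofReal_add (norm_nonneg _) (norm_nonneg _)]
  exact ENNReal.ofReal_le_ofReal h

lemma continuous_magPhase (hA : Continuous A) : Continuous fun q : E3 × E3 =>
    Complex.exp (-Complex.I *
      ((inner ℝ (q.1 - q.2) (A ((2 : ℝ)⁻¹ • (q.1 + q.2))) : ℝ) : ℂ)) := by
  fun_prop

lemma aestronglyMeasurable_magDiff (hA : Continuous A) (hu : AEStronglyMeasurable u) :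
    AEStronglyMeasurable (fun q : E3 × E3 => magDiff A u q.1 q.2) := by
  unfold magDiff
  exact ((continuous_magPhase hA).aestronglyMeasurable.mul hu.comp_fst).sub hu.comp_snd

lemma aestronglyMeasurable_magDiff_right (hA : Continuous A) (hu : AEStronglyMeasurable u)
    (y : E3) : AEStronglyMeasurable (fun z : E3 => magDiff A u y z) := by
  unfold magDiff
  refine AEStronglyMeasurable.sub ?_ hu
  exact (((continuous_magPhase hA).comp (by fun_prop : Continuous fun z : E3 => (y, z))).mul
    continuous_const).aestronglyMeasurable

lemma aemeasurable_magIntegrand (hA : Continuous A) (hu : AEStronglyMeasurable u) :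
    AEMeasurable (fun q : E3 × E3 => ‖magDiff A u q.1 q.2‖ₑ ^ 2 *
      ENNReal.ofReal (pseudorelKernel s m (q.1 - q.2))) := by
  refine ((aestronglyMeasurable_magDiff hA hu).enorm.pow_const 2).mul ?_
  exact ((measurable_pseudorelKernel s m).comp
    (measurable_fst.sub measurable_snd)).ennreal_ofReal.aemeasurable

lemma aemeasurable_magDensity (hA : Continuous A) (hu : AEStronglyMeasurable u) :
    AEMeasurable (magDensity A s m u) :=
  (aemeasurable_magIntegrand hA hu).lintegral_prod_right'

/-- Jensen's inequality for the square. -/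
lemma sq_lintegral_le {α : Type*} [MeasurableSpace α] {μ : Measure α} [IsProbabilityMeasure μ]
    {f : α → ENNReal} (hf : AEMeasurable f μ) :
    (∫⁻ x, f x ∂μ) ^ 2 ≤ ∫⁻ x, f x ^ 2 ∂μ := by
  have h := ENNReal.lintegral_mul_le_Lp_mul_Lq μ Real.HolderConjugate.two_two hf
    (aemeasurable_const (b := (1 : ENNReal)))
  simp only [Pi.mul_apply, mul_one, ENNReal.one_rpow, lintegral_const, measure_univ] at h
  calc (∫⁻ x, f x ∂μ) ^ 2 ≤ ((∫⁻ a, f a ^ (2 : ℝ) ∂μ) ^ (1 / (2 : ℝ))) ^ 2 := by gcongr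
    _ = _ := by
      rw [← ENNReal.rpow_natCast, ← ENNReal.rpow_mul]
      norm_num

/-- The uniform probability measure on a ball of `ℝ³`. -/
def ballMeasure (x : E3) (r : ℝ) : Measure E3 :=
  (volume (Metric.ball x r))⁻¹ • volume.restrict (Metric.ball x r)

lemma isProbabilityMeasure_ballMeasure (x : E3) {r : ℝ} (hr : 0 < r) :
    IsProbabilityMeasure (ballMeasure x r) := by
  refine ⟨?_⟩
  rw [ballMeasure, Measure.smul_apply, Measure.restrict_apply_univ, smul_eq_mul]
  exact ENNReal.inv_mul_cancel (Metric.measure_ball_pos _ _ hr).ne' measure_ball_lt_top.ne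

lemma ballMeasure_absolutelyContinuous (x : E3) (r : ℝ) : ballMeasure x r ≪ volume :=
  (Measure.smul_absolutelyContinuous).trans Measure.restrict_le_self.absolutelyContinuous

lemma ae_ballMeasure_mem (x : E3) (r : ℝ) : ∀ᵐ y ∂ballMeasure x r, y ∈ Metric.ball x r :=
  Measure.ae_smul_measure (ae_restrict_mem measurableSet_ball) _

/-- The constant `v` is the inverse volume of the unit ball of `ℝ³`, which makes the factor `r⁻³`
explicit. -/
lemma exists_lintegral_ballMeasure_eq : ∃ v : ℝ, 0 < v ∧ ∀ (x : E3) (r : ℝ), 0 < r →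
    ∀ f : E3 → ENNReal, ∫⁻ y, f y ∂ballMeasure x r =
      ENNReal.ofReal (v * r⁻¹ ^ 3) * ∫⁻ y in Metric.ball x r, f y := by
  obtain ⟨V, hV, hV'⟩ : ∃ V : ℝ, 0 < V ∧ volume (Metric.ball (0 : E3) 1) = ENNReal.ofReal V :=
    ⟨(volume (Metric.ball (0 : E3) 1)).toReal,
      ENNReal.toReal_pos (Metric.measure_ball_pos _ _ one_pos).ne' measure_ball_lt_top.ne,
      (ENNReal.ofReal_toReal measure_ball_lt_top.ne).symm⟩
  refine ⟨V⁻¹, by positivity, fun x r hr f => ?_⟩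
  rw [ballMeasure, lintegral_smul_measure, smul_eq_mul, Measure.addHaar_ball_of_pos _ _ hr, hV',
    ← ENNReal.ofReal_mul (by positivity), ← ENNReal.ofReal_inv_of_pos (by positivity)]
  congr 2
  simp [mul_comm]

lemma enorm_le_lintegral_ballMeasure_add (hu : AEStronglyMeasurable u)
    (x y : E3) {r : ℝ} (hr : 0 < r) :
    ‖u y‖ₑ ≤ (∫⁻ z, ‖u z‖ₑ ∂ballMeasure x r) + ∫⁻ z, ‖magDiff A u y z‖ₑ ∂ballMeasure x r := by
  have := isProbabilityMeasure_ballMeasure x hr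
  have hac := ballMeasure_absolutelyContinuous x r
  rw [← lintegral_add_left' (hu.enorm.mono_ac hac)]
  calc ‖u y‖ₑ = ∫⁻ _z, ‖u y‖ₑ ∂ballMeasure x r := by simp
    _ ≤ _ := lintegral_mono fun z => enorm_le_enorm_add_magDiff y z

lemma exists_sq_magDiff_le (hs : 0 < s) (hm : 0 < m) : ∃ C : ℝ, 0 < C ∧
    ∀ (A : E3 → E3) (u : E3 → ℂ) (y z : E3) (r : ℝ), r ≤ 1 → dist y z ≤ 2 * r →
      ‖magDiff A u y z‖ₑ ^ 2 ≤ ENNReal.ofReal (C * r ^ (3 + 2 * s)) *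
        (‖magDiff A u y z‖ₑ ^ 2 * ENNReal.ofReal (pseudorelKernel s m (y - z))) := by
  obtain ⟨c, hc, hk⟩ := exists_pseudorelKernel_ge hs hm
  refine ⟨c⁻¹ * 2 ^ (3 + 2 * s), by positivity, fun A u y z r hr1 hyz => ?_⟩
  rcases eq_or_ne y z with rfl | hne
  · simp [magDiff_self]
  have hr : 0 < r := by have := dist_pos.2 hne; linarith
  have h1 := hk (y - z) (sub_ne_zero.2 hne) (by rw [← dist_eq_norm]; linarith)
  have hk0 := pseudorelKernel_nonneg hs hm (y - z)
  have h2 : 1 ≤ c⁻¹ * 2 ^ (3 + 2 * s) * r ^ (3 + 2 * s) * pseudorelKernel s m (y - z) := by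
    rw [mul_assoc c⁻¹, ← Real.mul_rpow (by norm_num) hr.le, mul_assoc, ← div_eq_inv_mul,
      one_le_div hc]
    refine h1.trans ?_
    rw [← dist_eq_norm]
    gcongr
  rw [mul_left_comm, ← ENNReal.ofReal_mul (by positivity)]
  calc ‖magDiff A u y z‖ₑ ^ 2 = ‖magDiff A u y z‖ₑ ^ 2 * ENNReal.ofReal 1 := by simp
    _ ≤ _ := by gcongr

/-- On the ball the kernel is at least a multiple of `r^(-(3+2s))`, while averaging costs `r⁻³`. The
net gain is `r^(2s)`. -/
lemma exists_lintegral_sq_magDiff_le (hs : 0 < s) (hm : 0 < m) : ∃ C : ℝ, 0 < C ∧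
    ∀ (A : E3 → E3) (u : E3 → ℂ) (x y : E3) (r : ℝ), 0 < r → r ≤ 1 → y ∈ Metric.ball x r →
      ∫⁻ z, ‖magDiff A u y z‖ₑ ^ 2 ∂ballMeasure x r
        ≤ ENNReal.ofReal (C * r ^ (2 * s)) * magDensity A s m u y := by
  obtain ⟨C, hC, h⟩ := exists_sq_magDiff_le hs hm
  obtain ⟨v, hv, hb⟩ := exists_lintegral_ballMeasure_eq
  refine ⟨v * C, by positivity, fun A u x y r hr hr1 hy => ?_⟩
  rw [hb x r hr]
  calc ENNReal.ofReal (v * r⁻¹ ^ 3) * ∫⁻ z in Metric.ball x r, ‖magDiff A u y z‖ₑ ^ 2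
      ≤ ENNReal.ofReal (v * r⁻¹ ^ 3) * ∫⁻ z in Metric.ball x r,
        ENNReal.ofReal (C * r ^ (3 + 2 * s)) *
          (‖magDiff A u y z‖ₑ ^ 2 * ENNReal.ofReal (pseudorelKernel s m (y - z))) := by
        gcongr 1
        refine setLIntegral_mono' measurableSet_ball fun z hz => h A u y z r hr1 ?_
        have h1 := Metric.mem_ball.1 hy
        have h2 := Metric.mem_ball'.1 hz
        linarith [dist_triangle y x z]
    _ ≤ ENNReal.ofReal (v * r⁻¹ ^ 3) * (ENNReal.ofReal (C * r ^ (3 + 2 * s)) *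
          magDensity A s m u y) := by
        gcongr 1
        rw [lintegral_const_mul' _ _ ENNReal.ofReal_ne_top]
        gcongr 1
        exact setLIntegral_le_lintegral _ _
    _ = _ := by
        rw [← mul_assoc, ← ENNReal.ofReal_mul (by positivity)]
        congr 2
        rw [Real.rpow_add hr]
        norm_cast
        field_simp

/-! ### A pointwise Sobolev inequality by dyadic averages -/

lemma ENNReal.le_ofReal_of_sq_le {a : ENNReal} {b : ℝ} (hb : 0 ≤ b)
    (h : a ^ 2 ≤ ENNReal.ofReal (b ^ 2)) : a ≤ ENNReal.ofReal b := by
  rw [ENNReal.ofReal_pow hb] at h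
  exact (ENNReal.pow_le_pow_left_iff two_ne_zero).1 h

lemma lintegral_magDensity_ball_le {x : E3} {r : ℝ} (hr1 : r ≤ 1) :
    ∫⁻ y in Metric.ball x r, magDensity A s m u y
      ≤ ∫⁻ y in Metric.ball x 1, energyDensity A s m u y := by
  refine (lintegral_mono fun y => ?_).trans (lintegral_mono_set (Metric.ball_subset_ball hr1))
  exact le_add_self

/-- Bounds for the averages of `|u|` over the balls `B(x, 2⁻ᵏ)`. -/
lemma exists_lintegral_ballMeasure_le (hs : 0 < s) (hs1 : s < 1) (hm : 0 < m) :
    ∃ C : ℝ, 0 < C ∧ ∀ A : E3 → E3, Continuous A → ∀ u : E3 → ℂ, AEStronglyMeasurable u →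
      ∀ (x : E3) (M : ℝ), 0 < M →
        ∫⁻ y in Metric.ball x 1, energyDensity A s m u y ≤ ENNReal.ofReal (M ^ 2) →
        ∀ k : ℕ, ∫⁻ z, ‖u z‖ₑ ∂ballMeasure x ((1 / 2) ^ k)
          ≤ ENNReal.ofReal (C * ((2 : ℝ) ^ (3 / 2 - s)) ^ k * M) := by
  obtain ⟨v, hv, hb⟩ := exists_lintegral_ballMeasure_eq
  obtain ⟨C, hC, h⟩ := exists_lintegral_sq_magDiff_le hs hm
  set β : ℝ := (2 : ℝ) ^ (3 / 2 - s) with hβ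
  have hβ1 : 1 < β := Real.one_lt_rpow one_lt_two (by linarith)
  -- The two requirements on `C₁` are those of the induction below: `√v ≤ C₁` starts it, and `√(8vC)
  -- ≤ C₁ (β - 1)` absorbs the increment, since `C₁ β^k + C₁ (β - 1) β^k = C₁ β^(k+1)`.
  obtain ⟨C₁, hC₁, hC₁v, hC₁s⟩ : ∃ C₁ : ℝ, 0 < C₁ ∧ √v ≤ C₁ ∧ √(8 * v * C) ≤ C₁ * (β - 1) := by
    refine ⟨√v + √(8 * v * C) / (β - 1), ?_, ?_, ?_⟩
    · have : 0 < β - 1 := by linarith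
      positivity
    · have : 0 < β - 1 := by linarith
      have : 0 ≤ √(8 * v * C) / (β - 1) := by positivity
      linarith
    · have : 0 < β - 1 := by linarith
      rw [add_mul, div_mul_cancel₀ _ this.ne']
      have : 0 ≤ √v * (β - 1) := by positivity
      linarith
  refine ⟨C₁, hC₁, fun A hA u hu x M hM hE k => ?_⟩
  induction k with
  | zero =>
    have := isProbabilityMeasure_ballMeasure x one_pos
    simp only [pow_zero, mul_one]
    refine ENNReal.le_ofReal_of_sq_le (by positivity) ?_
    refine (sq_lintegral_le (hu.enorm.mono_ac (ballMeasure_absolutelyContinuous x 1))).trans ?_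
    rw [hb x 1 one_pos]
    calc ENNReal.ofReal (v * 1⁻¹ ^ 3) * ∫⁻ y in Metric.ball x 1, ‖u y‖ₑ ^ 2
        ≤ ENNReal.ofReal (v * 1⁻¹ ^ 3) * ENNReal.ofReal (M ^ 2) := by
          gcongr
          exact (lintegral_mono fun y => le_self_add).trans hE
      _ = ENNReal.ofReal (v * M ^ 2) := by
          rw [← ENNReal.ofReal_mul (by positivity)]; simp
      _ ≤ _ := by
          refine ENNReal.ofReal_le_ofReal ?_
          rw [mul_pow]
          gcongr
          exact (Real.sqrt_le_left hC₁.le).1 hC₁v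
  | succ k ih =>
    set r : ℝ := (1 / 2) ^ k with hr
    have hr0 : 0 < r := by positivity
    have hr1 : r ≤ 1 := pow_le_one₀ (by norm_num) (by norm_num)
    have hr2 : (1 / 2 : ℝ) ^ (k + 1) = r / 2 := by rw [pow_succ]; ring
    rw [hr2]
    have hP := isProbabilityMeasure_ballMeasure x (half_pos hr0)
    have hac := ballMeasure_absolutelyContinuous x (r / 2)
    have hrβ : r ^ (2 * s) * r⁻¹ ^ 3 = (β ^ k) ^ 2 := by
      have hr' : r = (2 : ℝ) ^ (-(k : ℝ)) := by
        rw [hr, Real.rpow_neg (by norm_num), Real.rpow_natCast]; simp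
      rw [hβ, ← Real.rpow_natCast (_ ^ _) k, ← Real.rpow_natCast _ 2, ← Real.rpow_natCast _ 3, hr',
        ← Real.rpow_neg (by norm_num), ← Real.rpow_mul (by positivity),
        ← Real.rpow_mul (by positivity),
        ← Real.rpow_mul (by positivity), ← Real.rpow_mul (by positivity),
        ← Real.rpow_add (by norm_num)]
      congr 1
      push_cast
      ring
    have hG := aemeasurable_magDensity (s := s) (m := m) hA hu
    have hsq : ∀ y ∈ Metric.ball x (r / 2), ∫⁻ z, ‖magDiff A u y z‖ₑ ∂ballMeasure x r
        ≤ (ENNReal.ofReal (C * r ^ (2 * s)) * magDensity A s m u y) ^ (1 / 2 : ℝ) := by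
      intro y hy
      have := isProbabilityMeasure_ballMeasure x hr0
      rw [← ENNReal.rpow_le_rpow_iff (z := 2) (by norm_num), ← ENNReal.rpow_mul]
      norm_num
      exact (sq_lintegral_le ((aestronglyMeasurable_magDiff_right hA hu y).enorm.mono_ac
        (ballMeasure_absolutelyContinuous x r))).trans
        (h A u x y r hr0 hr1 (Metric.ball_subset_ball (by linarith) hy))
    -- The passage from `B(x, r)` to `B(x, r/2)` costs, by Jensen, at most the square root of `v
    -- (r/2)⁻³ · C r^(2s) · M²`. The `8` comes from `(r/2)⁻³`, and `hrβ` rewrites the powers of `r`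
    -- as `β^(2k)`.
    have hstep : ∫⁻ y, (ENNReal.ofReal (C * r ^ (2 * s)) * magDensity A s m u y) ^ (1 / 2 : ℝ)
        ∂ballMeasure x (r / 2) ≤ ENNReal.ofReal (√(8 * v * C) * β ^ k * M) := by
      refine ENNReal.le_ofReal_of_sq_le (by positivity) ?_
      refine (sq_lintegral_le (((hG.const_mul _).pow_const _).mono_ac hac)).trans ?_
      calc ∫⁻ y, ((ENNReal.ofReal (C * r ^ (2 * s)) * magDensity A s m u y) ^ (1 / 2 : ℝ)) ^ 2
            ∂ballMeasure x (r / 2)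
          = ∫⁻ y, ENNReal.ofReal (C * r ^ (2 * s)) * magDensity A s m u y
            ∂ballMeasure x (r / 2) := by
            refine lintegral_congr fun y => ?_
            rw [← ENNReal.rpow_natCast, ← ENNReal.rpow_mul]
            norm_num
        _ = ENNReal.ofReal (v * (r / 2)⁻¹ ^ 3) * (ENNReal.ofReal (C * r ^ (2 * s)) *
              ∫⁻ y in Metric.ball x (r / 2), magDensity A s m u y) := by
            rw [hb x _ (half_pos hr0), lintegral_const_mul' _ _ ENNReal.ofReal_ne_top]
        _ ≤ ENNReal.ofReal (v * (r / 2)⁻¹ ^ 3) * (ENNReal.ofReal (C * r ^ (2 * s)) *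
              ENNReal.ofReal (M ^ 2)) := by
            gcongr
            exact (lintegral_magDensity_ball_le (by linarith)).trans hE
        _ = ENNReal.ofReal ((√(8 * v * C) * β ^ k * M) ^ 2) := by
            rw [← ENNReal.ofReal_mul (by positivity), ← ENNReal.ofReal_mul (by positivity)]
            congr 1
            rw [mul_pow, mul_pow, ← hrβ, Real.sq_sqrt (by positivity)]
            field_simp
            norm_num
    calc ∫⁻ z, ‖u z‖ₑ ∂ballMeasure x (r / 2)
        ≤ ∫⁻ y, ((∫⁻ z, ‖u z‖ₑ ∂ballMeasure x r) +
          (ENNReal.ofReal (C * r ^ (2 * s)) * magDensity A s m u y) ^ (1 / 2 : ℝ))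
            ∂ballMeasure x (r / 2) := by
          refine lintegral_mono_ae ?_
          filter_upwards [ae_ballMeasure_mem x (r / 2)] with y hy
          exact (enorm_le_lintegral_ballMeasure_add hu x y hr0).trans (by gcongr; exact hsq y hy)
      _ = (∫⁻ z, ‖u z‖ₑ ∂ballMeasure x r) +
          ∫⁻ y, (ENNReal.ofReal (C * r ^ (2 * s)) * magDensity A s m u y) ^ (1 / 2 : ℝ)
            ∂ballMeasure x (r / 2) := by
          rw [lintegral_add_left measurable_const]; simp
      _ ≤ ENNReal.ofReal (C₁ * β ^ k * M) + ENNReal.ofReal (√(8 * v * C) * β ^ k * M) :=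
          add_le_add ih hstep
      _ ≤ _ := by
          rw [← ENNReal.ofReal_add (by positivity) (by positivity)]
          refine ENNReal.ofReal_le_ofReal ?_
          have : √(8 * v * C) * (β ^ k * M) ≤ C₁ * (β - 1) * (β ^ k * M) := by gcongr
          calc _ ≤ C₁ * β ^ k * M + C₁ * (β - 1) * (β ^ k * M) := by linarith
            _ = _ := by rw [pow_succ]; ring

/-- A pointwise Sobolev inequality: if the energy of `u` on the unit ball around `x` is at most
`M²`, then `|u(x)|^p` is controlled by `M^(p-2)` times the energy density at `x`. -/
lemma exists_enorm_rpow_le (hs : 0 < s) (hs1 : s < 1) (hm : 0 < m) (hp2 : 2 < p)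
    (hp : p ≤ 6 / (3 - 2 * s)) :
    ∃ C : ℝ, 0 < C ∧ ∀ A : E3 → E3, Continuous A → ∀ u : E3 → ℂ, AEStronglyMeasurable u →
      ∀ (x : E3) (M : ℝ), 0 < M →
        ∫⁻ y in Metric.ball x 1, energyDensity A s m u y ≤ ENNReal.ofReal (M ^ 2) →
        ‖u x‖ₑ ^ p ≤ ENNReal.ofReal (C * M ^ (p - 2)) * energyDensity A s m u x := by
  obtain ⟨C₁, hC₁, h₁⟩ := exists_lintegral_ballMeasure_le hs hs1 hm
  obtain ⟨C₂, hC₂, h₂⟩ := exists_lintegral_sq_magDiff_le hs hm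
  set β : ℝ := (2 : ℝ) ^ (3 / 2 - s) with hβ
  have hβ1 : 1 < β := Real.one_lt_rpow one_lt_two (by linarith)
  have hp2' : 0 < p - 2 := by linarith
  refine ⟨(2 * C₁) ^ (p - 2) + (2 * C₁ * β) ^ (p - 2) * 4 * C₂, by positivity,
    fun A hA u hu x M hM hE => ?_⟩
  have hf : ‖u x‖ₑ ^ p = ENNReal.ofReal (‖u x‖ ^ (p - 2)) * ‖u x‖ₑ ^ 2 := by
    rw [← ofReal_norm, ENNReal.ofReal_rpow_of_nonneg (norm_nonneg _) (by linarith),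
      ← ENNReal.ofReal_pow (norm_nonneg _), ← ENNReal.ofReal_mul (by positivity)]
    congr 1
    rcases (norm_nonneg (u x)).eq_or_lt with h0 | h0
    · rw [← h0, Real.zero_rpow (by linarith)]; simp
    · rw [← Real.rpow_natCast, ← Real.rpow_add h0]; norm_num
  rw [hf]
  -- If `|u(x)|` is at most the threshold, the `|u|²` part of the energy density suffices. Otherwise
  -- the magnetic part controls it.
  by_cases hcase : ‖u x‖ ≤ 2 * C₁ * M
  · gcongr
    · calc ‖u x‖ ^ (p - 2) ≤ (2 * C₁ * M) ^ (p - 2) := by gcongr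
        _ = (2 * C₁) ^ (p - 2) * M ^ (p - 2) := Real.mul_rpow (by positivity) hM.le
        _ ≤ _ := by gcongr; exact le_add_of_nonneg_right (by positivity)
    · exact le_self_add
  · push Not at hcase
    obtain ⟨n, hn⟩ : ∃ n : ℕ, ‖u x‖ ≤ 2 * C₁ * M * β ^ n := by
      obtain ⟨n, hn⟩ := pow_unbounded_of_one_lt (‖u x‖ / (2 * C₁ * M)) hβ1
      refine ⟨n, ?_⟩
      rw [div_lt_iff₀ (by positivity)] at hn
      linarith
    classical
    -- The scale `2^(-k)` is chosen so that the average of `|u|` over `B(x, 2^(-k))` stays below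
    -- `|u(x)|/2`, while `|u(x)|` is still comparable to `M β^k`. The least exponent is nonzero
    -- because the small case is excluded.
    obtain ⟨k, hk1, hk2⟩ : ∃ k : ℕ, 2 * C₁ * M * β ^ k < ‖u x‖ ∧
        ‖u x‖ ≤ 2 * C₁ * M * β ^ (k + 1) := by
      have hex : ∃ n : ℕ, ‖u x‖ ≤ 2 * C₁ * M * β ^ n := ⟨n, hn⟩
      have h0 : Nat.find hex ≠ 0 := fun h0 => by
        have := Nat.find_spec hex
        rw [h0, pow_zero, mul_one] at this
        linarith
      obtain ⟨k, hk⟩ := Nat.exists_eq_succ_of_ne_zero h0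
      refine ⟨k, ?_, ?_⟩
      · have := Nat.find_min hex (m := k) (by omega)
        push Not at this
        exact this
      · have := Nat.find_spec hex
        rwa [hk] at this
    set r : ℝ := (1 / 2) ^ k with hr
    have hr0 : 0 < r := by positivity
    have hr1 : r ≤ 1 := pow_le_one₀ (by norm_num) (by norm_num)
    have hP := isProbabilityMeasure_ballMeasure x hr0
    have ha := h₁ A hA u hu x M hM hE k
    have hsplit := (enorm_le_lintegral_ballMeasure_add (A := A) hu x x hr0).trans
      (add_le_add_left ha _)
    have hhalf : ENNReal.ofReal (‖u x‖ / 2) ≤ ∫⁻ z, ‖magDiff A u x z‖ₑ ∂ballMeasure x r := by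
      have h1 : ENNReal.ofReal (C₁ * β ^ k * M) ≤ ENNReal.ofReal (‖u x‖ / 2) :=
        ENNReal.ofReal_le_ofReal (by linarith)
      have h2 := hsplit.trans (add_le_add_left h1 _)
      rw [← ofReal_norm, show ‖u x‖ = ‖u x‖ / 2 + ‖u x‖ / 2 by ring,
        ENNReal.ofReal_add (by positivity) (by positivity)] at h2
      simp only [add_halves] at h2
      exact (ENNReal.add_le_add_iff_left ENNReal.ofReal_ne_top).1 h2
    have hsq : ‖u x‖ₑ ^ 2 ≤ ENNReal.ofReal (4 * C₂ * r ^ (2 * s)) * magDensity A s m u x := by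
      calc ‖u x‖ₑ ^ 2 = ENNReal.ofReal 4 * ENNReal.ofReal (‖u x‖ / 2) ^ 2 := by
            rw [← ofReal_norm, ← ENNReal.ofReal_pow (by positivity),
              ← ENNReal.ofReal_pow (by positivity), ← ENNReal.ofReal_mul (by norm_num)]
            congr 1; ring
        _ ≤ ENNReal.ofReal 4 * ∫⁻ z, ‖magDiff A u x z‖ₑ ^ 2 ∂ballMeasure x r := by
            gcongr
            exact (pow_le_pow_left' hhalf 2).trans (sq_lintegral_le
              ((aestronglyMeasurable_magDiff_right hA hu x).enorm.mono_ac
                (ballMeasure_absolutelyContinuous x r)))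
        _ ≤ ENNReal.ofReal 4 * (ENNReal.ofReal (C₂ * r ^ (2 * s)) * magDensity A s m u x) := by
            gcongr
            exact h₂ A u x x r hr0 hr1 (Metric.mem_ball_self hr0)
        _ = _ := by
            rw [← mul_assoc, ← ENNReal.ofReal_mul (by norm_num)]
            congr 2; ring
    -- Here criticality enters: `(3/2 - s)(p - 2) ≤ 2s` is equivalent to `p ≤ 6/(3-2s)`, and it
    -- makes the bound independent of the scale `k`.
    have hexp : (β ^ (k + 1)) ^ (p - 2) * r ^ (2 * s) ≤ β ^ (p - 2) := by
      have hle : (3 / 2 - s) * (p - 2) ≤ 2 * s := by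
        rw [le_div_iff₀ (by linarith)] at hp
        nlinarith
      have hr' : r = (2 : ℝ) ^ (-(k : ℝ)) := by
        rw [hr, Real.rpow_neg (by norm_num), Real.rpow_natCast]; simp
      rw [hβ, hr', ← Real.rpow_natCast, ← Real.rpow_mul (by positivity),
        ← Real.rpow_mul (by positivity), ← Real.rpow_mul (by positivity),
        ← Real.rpow_mul (by positivity), ← Real.rpow_add (by norm_num)]
      refine Real.rpow_le_rpow_of_exponent_le (by norm_num) ?_
      push_cast
      have := mul_le_mul_of_nonneg_left hle (Nat.cast_nonneg (α := ℝ) k)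
      linarith
    calc ENNReal.ofReal (‖u x‖ ^ (p - 2)) * ‖u x‖ₑ ^ 2
        ≤ ENNReal.ofReal ((2 * C₁ * M * β ^ (k + 1)) ^ (p - 2)) *
          (ENNReal.ofReal (4 * C₂ * r ^ (2 * s)) * magDensity A s m u x) := by gcongr
      _ = ENNReal.ofReal ((2 * C₁ * M * β ^ (k + 1)) ^ (p - 2) * (4 * C₂ * r ^ (2 * s))) *
          magDensity A s m u x := by
          rw [← mul_assoc, ← ENNReal.ofReal_mul (by positivity)]
      _ ≤ _ := by
          refine mul_le_mul' (ENNReal.ofReal_le_ofReal ?_) le_add_self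
          rw [Real.mul_rpow (by positivity) (by positivity), Real.mul_rpow (by positivity) hM.le]
          calc (2 * C₁) ^ (p - 2) * M ^ (p - 2) * (β ^ (k + 1)) ^ (p - 2) *
                (4 * C₂ * r ^ (2 * s))
              = ((2 * C₁) ^ (p - 2) * 4 * C₂ * M ^ (p - 2)) *
                ((β ^ (k + 1)) ^ (p - 2) * r ^ (2 * s)) := by ring
            _ ≤ ((2 * C₁) ^ (p - 2) * 4 * C₂ * M ^ (p - 2)) * β ^ (p - 2) := by gcongr
            _ = (2 * C₁ * β) ^ (p - 2) * 4 * C₂ * M ^ (p - 2) := by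
              rw [Real.mul_rpow (x := 2 * C₁) (by positivity) (by positivity)]; ring
            _ ≤ _ := by gcongr; exact le_add_of_nonneg_left (by positivity)

/-! ### Embedding of the energy space in an `L²` Hilbert space -/

/-- The constant `(C_s/2) m^((3+2s)/2)` in front of the Gagliardo form. -/
def gagConst (s m : ℝ) : ℝ := pseudorelConst s / 2 * m ^ ((3 + 2 * s) / 2)

lemma gagConst_pos (hs : 0 < s) (hs1 : s < 1) (hm : 0 < m) : 0 < gagConst s m := by
  have h1 : 0 < Real.Gamma (1 - s) := Real.Gamma_pos_of_pos (by linarith)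
  have := Real.pi_pos
  unfold gagConst pseudorelConst
  positivity

/-- The square root of the weight of the Gagliardo form. -/
def gagWeight (s m : ℝ) (q : E3 × E3) : ℝ :=
  √(gagConst s m * pseudorelKernel s m (q.1 - q.2))

lemma measurable_gagWeight (s m : ℝ) : Measurable (gagWeight s m) :=
  (((measurable_pseudorelKernel s m).comp
    (measurable_fst.sub measurable_snd)).const_mul _).sqrt

lemma gagWeight_sq (hs : 0 < s) (hs1 : s < 1) (hm : 0 < m) (q : E3 × E3) :
    gagWeight s m q ^ 2 = gagConst s m * pseudorelKernel s m (q.1 - q.2) :=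
  Real.sq_sqrt (mul_nonneg (gagConst_pos hs hs1 hm).le (pseudorelKernel_nonneg hs hm _))

/-- The weighted magnetic difference, whose `L²` norm is the Gagliardo seminorm. -/
def weightedDiff (A : E3 → E3) (s m : ℝ) (u : E3 → ℂ) (q : E3 × E3) : ℂ :=
  (gagWeight s m q : ℂ) * magDiff A u q.1 q.2

lemma magDiff_add (x y : E3) : magDiff A (fun z => u z + v z) x y
    = magDiff A u x y + magDiff A v x y := by simp only [magDiff]; ring

lemma magDiff_const_mul (a : ℂ) (x y : E3) : magDiff A (fun z => a * u z) x y
    = a * magDiff A u x y := by simp only [magDiff]; ring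

lemma magDiff_sub (x y : E3) : magDiff A (fun z => u z - v z) x y
    = magDiff A u x y - magDiff A v x y := by simp only [magDiff]; ring

lemma aestronglyMeasurable_weightedDiff (hA : Continuous A) (hu : AEStronglyMeasurable u) :
    AEStronglyMeasurable (weightedDiff A s m u) := by
  unfold weightedDiff
  exact (Complex.measurable_ofReal.comp (measurable_gagWeight s m)).aestronglyMeasurable.mul
    (aestronglyMeasurable_magDiff hA hu)

lemma ae_prod_of_ae {P Q : E3 → Prop} (hP : ∀ᵐ x, P x) (hQ : ∀ᵐ x, Q x) :
    ∀ᵐ q : E3 × E3, P q.1 ∧ Q q.2 :=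
  (Measure.quasiMeasurePreserving_fst.ae hP).and (Measure.quasiMeasurePreserving_snd.ae hQ)

lemma weightedDiff_congr_ae (h : u =ᵐ[volume] v) :
    weightedDiff A s m u =ᵐ[volume] weightedDiff A s m v := by
  filter_upwards [ae_prod_of_ae h h] with q hq
  simp only [weightedDiff, magDiff, hq.1, hq.2]

/-- The Hilbert space in which the magnetic energy space is embedded. -/
abbrev MagSpace : Type :=
  WithLp 2 (Lp ℂ 2 (volume : Measure (E3 × E3)) × Lp ℂ 2 (volume : Measure E3))

/-- `U = (√w D_A u, m^s u)`. -/
def MagRepr (A : E3 → E3) (s m : ℝ) (u : E3 → ℂ) (U : MagSpace) : Prop :=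
  (U.fst : E3 × E3 → ℂ) =ᵐ[volume] weightedDiff A s m u ∧
    (U.snd : E3 → ℂ) =ᵐ[volume] fun x => ((m ^ s : ℝ) : ℂ) * u x

/-- The function represented by an element of `MagSpace`. -/
def magFun (s m : ℝ) (U : MagSpace) (x : E3) : ℂ := ((m ^ s : ℝ) : ℂ)⁻¹ * U.snd x

lemma MagRepr.ae_eq_magFun (hm : 0 < m) {U : MagSpace} (h : MagRepr A s m u U) :
    magFun s m U =ᵐ[volume] u := by
  have hms : ((m ^ s : ℝ) : ℂ) ≠ 0 := by exact_mod_cast (Real.rpow_pos_of_pos hm s).ne'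
  filter_upwards [h.2] with x hx
  rw [magFun, hx, inv_mul_cancel_left₀ hms]

lemma MagRepr.congr {U : MagSpace} (h : MagRepr A s m u U) (huv : u =ᵐ[volume] v) :
    MagRepr A s m v U :=
  ⟨h.1.trans (weightedDiff_congr_ae huv), h.2.trans (huv.mono fun x hx => by simp only [hx])⟩

lemma MagRepr.add {U V : MagSpace} (hU : MagRepr A s m u U) (hV : MagRepr A s m v V) :
    MagRepr A s m (fun x => u x + v x) (U + V) := by
  constructor
  · filter_upwards [hU.1, hV.1, Lp.coeFn_add U.fst V.fst] with q h1 h2 h3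
    rw [WithLp.add_fst, h3, Pi.add_apply, h1, h2]
    simp only [weightedDiff, magDiff_add]; ring
  · filter_upwards [hU.2, hV.2, Lp.coeFn_add U.snd V.snd] with q h1 h2 h3
    rw [WithLp.add_snd, h3, Pi.add_apply, h1, h2]; ring

lemma MagRepr.sub {U V : MagSpace} (hU : MagRepr A s m u U) (hV : MagRepr A s m v V) :
    MagRepr A s m (fun x => u x - v x) (U - V) := by
  constructor
  · filter_upwards [hU.1, hV.1, Lp.coeFn_sub U.fst V.fst] with q h1 h2 h3
    rw [WithLp.sub_fst, h3, Pi.sub_apply, h1, h2]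
    simp only [weightedDiff, magDiff_sub]; ring
  · filter_upwards [hU.2, hV.2, Lp.coeFn_sub U.snd V.snd] with q h1 h2 h3
    rw [WithLp.sub_snd, h3, Pi.sub_apply, h1, h2]; ring

lemma MagRepr.smul (a : ℂ) {U : MagSpace} (hU : MagRepr A s m u U) :
    MagRepr A s m (fun x => a * u x) (a • U) := by
  constructor
  · filter_upwards [hU.1, Lp.coeFn_smul a U.fst] with q h1 h3
    rw [WithLp.smul_fst, h3, Pi.smul_apply, h1, smul_eq_mul]
    simp only [weightedDiff, magDiff_const_mul]; ring
  · filter_upwards [hU.2, Lp.coeFn_smul a U.snd] with q h1 h3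
    rw [WithLp.smul_snd, h3, Pi.smul_apply, h1, smul_eq_mul]; ring

lemma magRepr_zero : MagRepr A s m (fun _ => 0) 0 := by
  constructor
  · filter_upwards [Lp.coeFn_zero ℂ 2 (volume : Measure (E3 × E3))] with q h
    rw [WithLp.zero_fst, h]
    simp [weightedDiff, magDiff]
  · filter_upwards [Lp.coeFn_zero ℂ 2 (volume : Measure E3)] with q h
    rw [WithLp.zero_snd, h]; simp

lemma MagRepr.memLp (hm : 0 < m) {U : MagSpace} (h : MagRepr A s m u U) : MemLp u 2 :=
  (memLp_congr_ae (h.ae_eq_magFun hm)).1 ((Lp.memLp U.snd).const_mul _)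

lemma norm_weightedDiff_sq (hs : 0 < s) (hs1 : s < 1) (hm : 0 < m) (q : E3 × E3) :
    ‖weightedDiff A s m u q‖ ^ 2 =
      gagConst s m * (‖magDiff A u q.1 q.2‖ ^ 2 * pseudorelKernel s m (q.1 - q.2)) := by
  rw [weightedDiff, norm_mul, mul_pow, Complex.norm_real, Real.norm_eq_abs, sq_abs,
    gagWeight_sq hs hs1 hm]
  ring

lemma gagliardoIntegrand_self (q : E3 × E3) : gagliardoIntegrand A s m u u q =
    ((‖magDiff A u q.1 q.2‖ ^ 2 * pseudorelKernel s m (q.1 - q.2) : ℝ) : ℂ) := by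
  rw [gagliardoIntegrand, Complex.mul_conj, Complex.normSq_eq_norm_sq]
  push_cast; rfl

lemma memMagH_iff_memLp (hs : 0 < s) (hs1 : s < 1) (hm : 0 < m) (hA : Continuous A) :
    MemMagH A s m u ↔ MemLp u 2 ∧ MemLp (weightedDiff A s m u) 2 := by
  refine and_congr_right fun hu => ?_
  have hc := gagConst_pos hs hs1 hm
  rw [memLp_two_iff_integrable_sq_norm (aestronglyMeasurable_weightedDiff hA hu.1)]
  simp_rw [norm_weightedDiff_sq hs hs1 hm]
  rw [integrable_const_mul_iff hc.ne'.isUnit]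
  have h1 : gagliardoIntegrand A s m u u = fun q =>
      ((‖magDiff A u q.1 q.2‖ ^ 2 * pseudorelKernel s m (q.1 - q.2) : ℝ) : ℂ) :=
    funext gagliardoIntegrand_self
  rw [h1]
  exact ⟨fun h => h.re, fun h => h.ofReal⟩

lemma memMagH_iff_exists_magRepr (hs : 0 < s) (hs1 : s < 1) (hm : 0 < m) (hA : Continuous A) :
    MemMagH A s m u ↔ ∃ U, MagRepr A s m u U := by
  rw [memMagH_iff_memLp hs hs1 hm hA]
  constructor
  · rintro ⟨h1, h2⟩
    refine ⟨WithLp.toLp 2 (h2.toLp, (h1.const_mul ((m ^ s : ℝ) : ℂ)).toLp), ?_, ?_⟩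
    · exact h2.coeFn_toLp
    · exact (h1.const_mul ((m ^ s : ℝ) : ℂ)).coeFn_toLp
  · rintro ⟨U, hU⟩
    exact ⟨hU.memLp hm, (memLp_congr_ae hU.1).1 (Lp.memLp U.fst)⟩

/-- The weights `√(gagConst · kernel)` and `m^s` square to the two coefficients of the form. The
order is reversed because `inner ℂ` is conjugate-linear in its first argument. -/
lemma magInner_eq_re_inner (hs : 0 < s) (hs1 : s < 1) (hm : 0 < m) {U V : MagSpace}
    (hU : MagRepr A s m u U) (hV : MagRepr A s m v V) :
    magInner A s m u v = (inner ℂ V U).re := by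
  have h1 : inner ℂ V.fst U.fst = (gagConst s m : ℂ) * ∫ q, gagliardoIntegrand A s m u v q := by
    rw [L2.inner_def, ← integral_const_mul]
    refine integral_congr_ae ?_
    filter_upwards [hU.1, hV.1] with q h1 h2
    have h3 : (gagWeight s m q : ℂ) ^ 2
        = (gagConst s m : ℂ) * (pseudorelKernel s m (q.1 - q.2) : ℂ) := by
      exact_mod_cast gagWeight_sq hs hs1 hm q
    rw [RCLike.inner_apply, h1, h2, weightedDiff, weightedDiff, map_mul, Complex.conj_ofReal,
      gagliardoIntegrand]
    linear_combination (magDiff A u q.1 q.2 * conj (magDiff A v q.1 q.2)) * h3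
  have h2 : inner ℂ V.snd U.snd = ((m ^ (2 * s) : ℝ) : ℂ) * ∫ x, u x * conj (v x) := by
    rw [L2.inner_def, ← integral_const_mul]
    refine integral_congr_ae ?_
    filter_upwards [hU.2, hV.2] with q h1 h2
    have h3 : ((m ^ (2 * s) : ℝ) : ℂ) = ((m ^ s : ℝ) : ℂ) ^ 2 := by
      rw [← Complex.ofReal_pow, ← Real.rpow_natCast, ← Real.rpow_mul hm.le]
      congr 2; push_cast; ring
    rw [RCLike.inner_apply, h1, h2, map_mul, Complex.conj_ofReal, h3]
    ring
  have h3 : inner ℂ V U = inner ℂ V.fst U.fst + inner ℂ V.snd U.snd :=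
    WithLp.prod_inner_apply V U
  rw [h3, h1, h2, Complex.add_re, Complex.re_ofReal_mul, Complex.re_ofReal_mul, magInner, gagConst]

lemma magNormSq_eq_norm_sq (hs : 0 < s) (hs1 : s < 1) (hm : 0 < m) {U : MagSpace}
    (hU : MagRepr A s m u U) : magNormSq A s m u = ‖U‖ ^ 2 := by
  rw [magNormSq, magInner_eq_re_inner hs hs1 hm hU hU, inner_self_eq_norm_sq_to_K]
  norm_cast

lemma exists_subseq_ae_tendsto {α : Type*} [MeasurableSpace α] {μ : Measure α}
    {f : ℕ → Lp ℂ 2 μ} {g : Lp ℂ 2 μ} (h : Tendsto f atTop (𝓝 g)) :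
    ∃ ns : ℕ → ℕ, StrictMono ns ∧ ∀ᵐ x ∂μ, Tendsto (fun i => f (ns i) x) atTop (𝓝 (g x)) :=
  (tendstoInMeasure_of_tendsto_Lp h).exists_seq_tendsto_ae

lemma magRepr_exists_subseq_ae_tendsto (hm : 0 < m) {f : ℕ → E3 → ℂ} {F : ℕ → MagSpace}
    {G : MagSpace} (hF : ∀ n, MagRepr A s m (f n) (F n)) (h : Tendsto F atTop (𝓝 G)) :
    ∃ ns : ℕ → ℕ, StrictMono ns ∧
      ∀ᵐ x, Tendsto (fun i => f (ns i) x) atTop (𝓝 (magFun s m G x)) := by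
  have h2 : Tendsto (fun n => (F n).snd) atTop (𝓝 G.snd) :=
    ((WithLp.continuous_snd 2 _ _).tendsto G).comp h
  obtain ⟨ns, hns, hae⟩ := exists_subseq_ae_tendsto h2
  refine ⟨ns, hns, ?_⟩
  have h3 : ∀ᵐ x, ∀ n, magFun s m (F n) x = f n x :=
    ae_all_iff.2 fun n => (hF n).ae_eq_magFun hm
  filter_upwards [hae, h3] with x hx h3x
  simp_rw [← h3x]
  exact hx.const_mul _

/-- The range of the embedding into `MagSpace` is closed. -/
lemma magRepr_of_tendsto (hm : 0 < m) {f : ℕ → E3 → ℂ} {F : ℕ → MagSpace}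
    {G : MagSpace} (hF : ∀ n, MagRepr A s m (f n) (F n)) (h : Tendsto F atTop (𝓝 G)) :
    MagRepr A s m (magFun s m G) G := by
  have hms : ((m ^ s : ℝ) : ℂ) ≠ 0 := by exact_mod_cast (Real.rpow_pos_of_pos hm s).ne'
  refine ⟨?_, ae_of_all _ fun x => ?_⟩
  · obtain ⟨ns, hns, hae⟩ := magRepr_exists_subseq_ae_tendsto hm hF h
    have h1 : Tendsto (fun n => (F (ns n)).fst) atTop (𝓝 G.fst) :=
      (((WithLp.continuous_fst 2 _ _).tendsto G).comp h).comp hns.tendsto_atTop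
    obtain ⟨ms, hms', hae1⟩ := exists_subseq_ae_tendsto h1
    have h3 : ∀ᵐ q, ∀ n, (F n).fst q = weightedDiff A s m (f n) q :=
      ae_all_iff.2 fun n => (hF n).1
    -- The functions converge almost everywhere along a subsequence, hence in both coordinates of
    -- almost every pair, so their weighted differences converge pointwise. This limit must agree
    -- with the `L²` limit taken along a further subsequence.
    filter_upwards [hae1, h3, ae_prod_of_ae hae hae] with q hq h3q hq2
    refine tendsto_nhds_unique hq ?_
    simp_rw [h3q, weightedDiff, magDiff]
    have ha := hq2.1.comp hms'.tendsto_atTop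
    have hb := hq2.2.comp hms'.tendsto_atTop
    exact ((ha.const_mul _).sub hb).const_mul _
  · simp only [magFun]
    rw [mul_inv_cancel_left₀ hms]

/-- Test functions of finite energy, inside `MagSpace`. -/
def testSpace (A : E3 → E3) (s m : ℝ) : Submodule ℂ MagSpace where
  carrier := {U | ∃ φ : E3 → ℂ, ContDiff ℝ ∞ φ ∧ HasCompactSupport φ ∧ MagRepr A s m φ U}
  add_mem' := by
    rintro U V ⟨φ, h1, h2, h3⟩ ⟨ψ, h4, h5, h6⟩
    exact ⟨_, h1.add h4, h2.add h5, h3.add h6⟩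
  zero_mem' := ⟨_, contDiff_const, HasCompactSupport.zero, magRepr_zero⟩
  smul_mem' := by
    rintro a U ⟨φ, h1, h2, h3⟩
    exact ⟨_, contDiff_const.mul h1, h2.mul_left, h3.smul a⟩

/-- `H^s_A`, inside `MagSpace`. -/
def HsASpace (A : E3 → E3) (s m : ℝ) : Submodule ℂ MagSpace := (testSpace A s m).topologicalClosure

lemma isClosed_HsASpace : IsClosed (HsASpace A s m : Set MagSpace) :=
  (testSpace A s m).isClosed_topologicalClosure

lemma magRepr_of_mem_HsASpace (hm : 0 < m) {U : MagSpace} (hU : U ∈ HsASpace A s m) :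
    MagRepr A s m (magFun s m U) U := by
  obtain ⟨F, hF, hlim⟩ := mem_closure_iff_seq_limit.1 hU
  choose f _ _ hf using hF
  exact magRepr_of_tendsto hm hf hlim

/-- Approximation in the energy norm is metric closure in `MagSpace`, since the embedding is
isometric. Closedness, weak limits and Riesz representation thus become available for `H^s_A`. -/
lemma memHsA_iff (hs : 0 < s) (hs1 : s < 1) (hm : 0 < m) (hA : Continuous A) :
    MemHsA A s m u ↔ ∃ U ∈ HsASpace A s m, MagRepr A s m u U := by
  rw [MemHsA, memMagH_iff_exists_magRepr hs hs1 hm hA]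
  constructor
  · rintro ⟨⟨U, hU⟩, h⟩
    refine ⟨U, Metric.mem_closure_iff.2 fun ε hε => ?_, hU⟩
    obtain ⟨φ, h1, h2, h3, h4⟩ := h (ε ^ 2) (by positivity)
    obtain ⟨V, hV⟩ := (memMagH_iff_exists_magRepr hs hs1 hm hA).1 h3
    refine ⟨U - V, ⟨φ, h1, h2, (hU.sub hV).congr (ae_of_all _ fun x => by simp)⟩, ?_⟩
    rw [dist_eq_norm, sub_sub_cancel]
    rw [magNormSq_eq_norm_sq hs hs1 hm hV] at h4
    exact lt_of_pow_lt_pow_left₀ 2 hε.le h4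
  · rintro ⟨U, hU, hr⟩
    refine ⟨⟨U, hr⟩, fun ε hε => ?_⟩
    obtain ⟨V, ⟨φ, h1, h2, h3⟩, h4⟩ := Metric.mem_closure_iff.1 hU (√ε) (Real.sqrt_pos.2 hε)
    refine ⟨φ, h1, h2, (memMagH_iff_exists_magRepr hs hs1 hm hA).2 ⟨_, hr.sub h3⟩, ?_⟩
    rw [magNormSq_eq_norm_sq hs hs1 hm (hr.sub h3), ← dist_eq_norm]
    exact (Real.lt_sqrt dist_nonneg).1 h4

/-! ### The action of `O(3)` and the radial subspace -/

lemma measurePreserving_prodMap (g : E3 ≃ₗᵢ[ℝ] E3) :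
    MeasurePreserving (Prod.map g g) (volume : Measure (E3 × E3)) volume :=
  g.measurePreserving.prod g.measurePreserving

lemma measurableEmbedding_prodMap (g : E3 ≃ₗᵢ[ℝ] E3) :
    MeasurableEmbedding (Prod.map g g : E3 × E3 → E3 × E3) :=
  (g.toHomeomorph.prodCongr g.toHomeomorph).measurableEmbedding

lemma measurableEmbedding_isometry (g : E3 ≃ₗᵢ[ℝ] E3) : MeasurableEmbedding g :=
  g.toHomeomorph.measurableEmbedding

/-- This is where the symmetry of the potential enters: it says exactly that the phase is invariant
under the simultaneous rotation of both points. -/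
lemma magDiff_comp (hiso : MagIsometryCondition A) (g : E3 ≃ₗᵢ[ℝ] E3) (x y : E3) :
    magDiff A (fun z => u (g z)) x y = magDiff A u (g x) (g y) := by
  have h := hiso x y g
  rw [map_sub, map_smul, map_add] at h
  simp only [magDiff]
  rw [h]

lemma gagliardoIntegrand_comp (hiso : MagIsometryCondition A) (g : E3 ≃ₗᵢ[ℝ] E3) (q : E3 × E3) :
    gagliardoIntegrand A s m (fun z => u (g z)) (fun z => v (g z)) q
      = gagliardoIntegrand A s m u v (Prod.map g g q) := by
  simp only [gagliardoIntegrand, magDiff_comp hiso, Prod.map_fst, Prod.map_snd]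
  rw [← map_sub, pseudorelKernel_map]

lemma magInner_comp (hiso : MagIsometryCondition A) (g : E3 ≃ₗᵢ[ℝ] E3) :
    magInner A s m (fun z => u (g z)) (fun z => v (g z)) = magInner A s m u v := by
  simp only [magInner]
  simp_rw [gagliardoIntegrand_comp hiso g]
  rw [(measurePreserving_prodMap g).integral_comp (measurableEmbedding_prodMap g)
    (gagliardoIntegrand A s m u v), g.measurePreserving.integral_comp
    (measurableEmbedding_isometry g) (fun x => u x * conj (v x))]

lemma memMagH_comp (hiso : MagIsometryCondition A) (g : E3 ≃ₗᵢ[ℝ] E3) (h : MemMagH A s m u) :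
    MemMagH A s m (fun z => u (g z)) := by
  refine ⟨h.1.comp_measurePreserving g.measurePreserving, ?_⟩
  have := ((measurePreserving_prodMap g).integrable_comp_emb
    (measurableEmbedding_prodMap g)).2 h.2
  refine this.congr (ae_of_all _ fun q => ?_)
  rw [gagliardoIntegrand_comp hiso]; rfl

lemma memHsA_comp (hiso : MagIsometryCondition A) (g : E3 ≃ₗᵢ[ℝ] E3) (h : MemHsA A s m u) :
    MemHsA A s m (fun z => u (g z)) := by
  refine ⟨memMagH_comp hiso g h.1, fun ε hε => ?_⟩
  obtain ⟨φ, h1, h2, h3, h4⟩ := h.2 ε hε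
  refine ⟨fun z => φ (g z), h1.comp g.contDiff, h2.comp_homeomorph g.toHomeomorph,
    memMagH_comp hiso g h3, ?_⟩
  rw [magNormSq, magInner_comp hiso g (u := fun x => u x - φ x) (v := fun x => u x - φ x)]
  exact h4

lemma ae_comp_isometry (g : E3 ≃ₗᵢ[ℝ] E3) {P : E3 → Prop} (h : ∀ᵐ x, P x) : ∀ᵐ x, P (g x) :=
  g.measurePreserving.quasiMeasurePreserving.ae h

lemma IsRadialAE.congr (h : IsRadialAE u) (huv : u =ᵐ[volume] v) : IsRadialAE v := fun g => by
  filter_upwards [h g, huv, ae_comp_isometry g huv] with x h1 h2 h3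
  rw [← h3, h1, h2]

/-- `H^s_{A,rad}`, inside `MagSpace`. -/
def radSpace (A : E3 → E3) (s m : ℝ) : Submodule ℂ MagSpace where
  carrier := {U | U ∈ HsASpace A s m ∧ ∃ u, MagRepr A s m u U ∧ IsRadialAE u}
  add_mem' := by
    rintro U V ⟨h1, u, h2, h3⟩ ⟨h4, v, h5, h6⟩
    refine ⟨add_mem h1 h4, _, h2.add h5, fun g => ?_⟩
    filter_upwards [h3 g, h6 g] with x h7 h8
    rw [h7, h8]
  zero_mem' := ⟨zero_mem _, _, magRepr_zero, fun g => by rfl⟩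
  smul_mem' := by
    rintro a U ⟨h1, u, h2, h3⟩
    refine ⟨Submodule.smul_mem _ a h1, _, h2.smul a, fun g => ?_⟩
    filter_upwards [h3 g] with x h7
    rw [h7]

lemma memHsARad_iff (hs : 0 < s) (hs1 : s < 1) (hm : 0 < m) (hA : Continuous A) :
    MemHsARad A s m u ↔ ∃ U ∈ radSpace A s m, MagRepr A s m u U := by
  rw [MemHsARad, memHsA_iff hs hs1 hm hA]
  constructor
  · rintro ⟨⟨U, hU, hr⟩, h⟩
    exact ⟨U, ⟨hU, u, hr, h⟩, hr⟩
  · rintro ⟨U, ⟨hU, v, hv, hvr⟩, hr⟩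
    exact ⟨⟨U, hU, hr⟩, hvr.congr ((hv.ae_eq_magFun hm).symm.trans (hr.ae_eq_magFun hm))⟩

/-- Invariance passes to almost everywhere limits of a subsequence, and each isometry preserves null
sets. -/
lemma isClosed_radSpace (hm : 0 < m) : IsClosed (radSpace A s m : Set MagSpace) := by
  refine IsSeqClosed.isClosed fun F G hF hG => ?_
  choose hF1 f hf hrad using hF
  refine ⟨isClosed_HsASpace.mem_of_tendsto hG (Eventually.of_forall hF1), magFun s m G,
    magRepr_of_tendsto hm hf hG, fun g => ?_⟩
  obtain ⟨ns, -, hae⟩ := magRepr_exists_subseq_ae_tendsto hm hf hG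
  filter_upwards [hae, ae_comp_isometry g hae, ae_all_iff.2 fun n => hrad n g] with x h1 h2 h3
  simp_rw [h3] at h2
  exact tendsto_nhds_unique h2 h1

/-! ### Weak sequential compactness -/

/-- Bounded sequences of a closed subspace of a Hilbert space have weakly convergent
subsequences. -/
lemma exists_subseq_weak_tendsto {H : Type*} [NormedAddCommGroup H] [InnerProductSpace ℂ H]
    [CompleteSpace H] {V : Submodule ℂ H} (hV : IsClosed (V : Set H)) {F : ℕ → H} {R : ℝ}
    (hF : ∀ n, F n ∈ V) (hR : ∀ n, ‖F n‖ ≤ R) :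
    ∃ G ∈ V, ∃ ns : ℕ → ℕ, StrictMono ns ∧
      ∀ W : H, Tendsto (fun n => inner ℂ W (F (ns n))) atTop (𝓝 (inner ℂ W G)) := by
  -- Sequential Banach-Alaoglu needs separability, so the argument runs in the closed span of the
  -- sequence. Arbitrary test vectors are then projected orthogonally onto it.
  set S : Submodule ℂ H := (Submodule.span ℂ (range F)).topologicalClosure with hS
  have hSc : IsClosed (S : Set H) := Submodule.isClosed_topologicalClosure _
  have hFS : ∀ n, F n ∈ S := fun n =>
    Submodule.le_topologicalClosure _ (Submodule.subset_span (mem_range_self n))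
  have hSV : S ≤ V := Submodule.topologicalClosure_minimal _
    (Submodule.span_le.2 (by rintro _ ⟨n, rfl⟩; exact hF n)) hV
  have : CompleteSpace S := hSc.completeSpace_coe
  have : TopologicalSpace.SeparableSpace S :=
    ((countable_range F).isSeparable.span (R := ℂ)).closure.separableSpace
  let F' : ℕ → S := fun n => ⟨F n, hFS n⟩
  obtain ⟨T, -, ns, hns, hT⟩ := WeakDual.isSeqCompact_closedBall ℂ S 0 R
    (x := fun n => StrongDual.toWeakDual (InnerProductSpace.toDual ℂ S (F' n))) (fun n => by
      simpa using hR n)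
  refine ⟨(InnerProductSpace.toDual ℂ S).symm (WeakDual.toStrongDual T), hSV (Subtype.mem _), ns,
    hns, fun W => ?_⟩
  set G := (InnerProductSpace.toDual ℂ S).symm (WeakDual.toStrongDual T)
  have h1 := ((WeakDual.eval_continuous (𝕜 := ℂ) (S.orthogonalProjectionOnto W)).tendsto T).comp hT
  have h2 : T (S.orthogonalProjectionOnto W) = inner ℂ G (S.orthogonalProjectionOnto W) := by
    rw [← InnerProductSpace.toDual_apply_apply, LinearIsometryEquiv.apply_symm_apply]; rfl
  have h3 : ∀ x : S, inner ℂ W (x : H) = conj (inner ℂ x (S.orthogonalProjectionOnto W)) := by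
    intro x
    rw [inner_conj_symm]
    exact (Submodule.inner_orthogonalProjectionOnto_eq_of_mem_right x W).symm
  have h4 : Tendsto (fun n => inner ℂ (F' (ns n)) (S.orthogonalProjectionOnto W)) atTop
      (𝓝 (inner ℂ G (S.orthogonalProjectionOnto W))) := by
    rw [← h2]; exact h1
  rw [h3 G]
  exact ((Complex.continuous_conj.tendsto _).comp h4).congr fun n => (h3 (F' (ns n))).symm

/-! ### Global energy bound and Sobolev inequality -/

lemma lintegral_enorm_sq_Lp {α : Type*} [MeasurableSpace α] {μ : Measure α} (f : Lp ℂ 2 μ) :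
    ∫⁻ x, ‖f x‖ₑ ^ 2 ∂μ = ENNReal.ofReal (‖f‖ ^ 2) := by
  have h := eLpNorm_nnreal_pow_eq_lintegral (f := f) (μ := μ) (p := 2) (by norm_num)
  rw [Lp.norm_def, ENNReal.ofReal_pow ENNReal.toReal_nonneg,
    ENNReal.ofReal_toReal (Lp.eLpNorm_ne_top f)]
  simp only [NNReal.coe_ofNat, ENNReal.rpow_ofNat, ENNReal.coe_ofNat] at h
  exact h.symm

lemma lintegral_magDensity (hA : Continuous A) (hu : AEStronglyMeasurable u) :
    ∫⁻ y, magDensity A s m u y = ∫⁻ q : E3 × E3, ‖magDiff A u q.1 q.2‖ₑ ^ 2 *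
      ENNReal.ofReal (pseudorelKernel s m (q.1 - q.2)) :=
  (lintegral_prod _ (aemeasurable_magIntegrand hA hu)).symm

/-- The energy is controlled by the norm of `MagSpace`. -/
lemma exists_lintegral_energyDensity_le (hs : 0 < s) (hs1 : s < 1) (hm : 0 < m) :
    ∃ K : ℝ, 0 < K ∧ ∀ A : E3 → E3, Continuous A → ∀ (u : E3 → ℂ) (U : MagSpace),
      MagRepr A s m u U → ∫⁻ y, energyDensity A s m u y ≤ ENNReal.ofReal (K * ‖U‖ ^ 2) := by
  have hc := gagConst_pos hs hs1 hm
  have hms : 0 < m ^ s := Real.rpow_pos_of_pos hm s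
  refine ⟨((m ^ s) ^ 2)⁻¹ + (gagConst s m)⁻¹, by positivity, fun A hA u U hU => ?_⟩
  have hu := (hU.memLp hm).1
  have h1 : ∫⁻ y, ‖u y‖ₑ ^ 2 = ENNReal.ofReal (((m ^ s) ^ 2)⁻¹ * ‖U.snd‖ ^ 2) := by
    rw [ENNReal.ofReal_mul (by positivity), ← lintegral_enorm_sq_Lp,
      ← lintegral_const_mul' _ _ ENNReal.ofReal_ne_top]
    refine lintegral_congr_ae ?_
    filter_upwards [hU.2] with x hx
    rw [hx, ← ofReal_norm, ← ofReal_norm, norm_mul, Complex.norm_real, Real.norm_of_nonneg hms.le,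
      ← ENNReal.ofReal_pow (by positivity), ← ENNReal.ofReal_pow (by positivity),
      ← ENNReal.ofReal_mul (by positivity)]
    congr 1
    field_simp
  have h2 : ∫⁻ y, magDensity A s m u y = ENNReal.ofReal ((gagConst s m)⁻¹ * ‖U.fst‖ ^ 2) := by
    rw [lintegral_magDensity hA hu, ENNReal.ofReal_mul (by positivity), ← lintegral_enorm_sq_Lp,
      ← lintegral_const_mul' _ _ ENNReal.ofReal_ne_top]
    refine lintegral_congr_ae ?_
    filter_upwards [hU.1] with q hq
    have hk := pseudorelKernel_nonneg hs hm (q.1 - q.2)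
    rw [hq, ← ofReal_norm, ← ofReal_norm, ← ENNReal.ofReal_pow (by positivity),
      ← ENNReal.ofReal_pow (by positivity), norm_weightedDiff_sq hs hs1 hm,
      ← ENNReal.ofReal_mul (by positivity), ← ENNReal.ofReal_mul (by positivity)]
    congr 1
    field_simp
  have h3 : ‖U‖ ^ 2 = ‖U.fst‖ ^ 2 + ‖U.snd‖ ^ 2 := WithLp.prod_norm_sq_eq_of_L2 U
  simp only [energyDensity]
  rw [lintegral_add_left' (hu.enorm.pow_const 2), h1, h2,
    ← ENNReal.ofReal_add (by positivity) (by positivity), h3]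
  refine ENNReal.ofReal_le_ofReal ?_
  have : 0 ≤ ((m ^ s) ^ 2)⁻¹ * ‖U.fst‖ ^ 2 := by positivity
  have : 0 ≤ (gagConst s m)⁻¹ * ‖U.snd‖ ^ 2 := by positivity
  linarith

/-- The fractional Sobolev inequality. -/
lemma exists_lintegral_rpow_le (hs : 0 < s) (hs1 : s < 1) (hm : 0 < m) (hp2 : 2 < p)
    (hp : p ≤ 6 / (3 - 2 * s)) :
    ∃ C : ℝ, 0 < C ∧ ∀ A : E3 → E3, Continuous A → ∀ (u : E3 → ℂ) (U : MagSpace),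
      MagRepr A s m u U → ∫⁻ x, ‖u x‖ₑ ^ p ≤ ENNReal.ofReal (C * ‖U‖ ^ p) := by
  obtain ⟨K, hK, hE⟩ := exists_lintegral_energyDensity_le hs hs1 hm
  obtain ⟨C, hC, h⟩ := exists_enorm_rpow_le hs hs1 hm hp2 hp
  refine ⟨C * √K ^ p, by positivity, fun A hA u U hU => ?_⟩
  rcases eq_or_ne U 0 with rfl | hU0
  · have h0 : ∀ᵐ x, ‖u x‖ₑ ^ p = 0 := by
      have h1 := hU.ae_eq_magFun hm
      have h2 := (magRepr_zero (A := A) (s := s) (m := m)).ae_eq_magFun hm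
      filter_upwards [h1, h2] with x h3 h4
      rw [← h3, h4, enorm_zero, ENNReal.zero_rpow_of_pos (by linarith)]
    rw [lintegral_congr_ae h0]; simp
  have hU1 : 0 < ‖U‖ := norm_pos_iff.2 hU0
  have hM : (√K * ‖U‖) ^ 2 = K * ‖U‖ ^ 2 := by rw [mul_pow, Real.sq_sqrt hK.le]
  have hE' := hE A hA u U hU
  -- The total energy bounds the energy of every unit ball, so the pointwise inequality holds with
  -- the same `M = √K ‖U‖` everywhere and can be integrated.
  calc ∫⁻ x, ‖u x‖ₑ ^ p
      ≤ ∫⁻ x, ENNReal.ofReal (C * (√K * ‖U‖) ^ (p - 2)) * energyDensity A s m u x := by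
        refine lintegral_mono fun x => h A hA u (hU.memLp hm).1 x _ (by positivity) ?_
        rw [hM]
        exact (setLIntegral_le_lintegral _ _).trans hE'
    _ ≤ ENNReal.ofReal (C * (√K * ‖U‖) ^ (p - 2)) * ENNReal.ofReal ((√K * ‖U‖) ^ 2) := by
        rw [lintegral_const_mul' _ _ ENNReal.ofReal_ne_top, hM]
        gcongr
    _ = _ := by
        rw [← ENNReal.ofReal_mul (by positivity), mul_assoc C, ← Real.rpow_natCast _ 2,
          ← Real.rpow_add (by positivity)]
        norm_num
        rw [Real.mul_rpow (by positivity) (by positivity), mul_assoc]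

/-! ### Uniform decay of radial functions -/

lemma energyDensity_congr_ae (h : u =ᵐ[volume] v) :
    energyDensity A s m u =ᵐ[volume] energyDensity A s m v := by
  filter_upwards [h] with y hy
  simp only [energyDensity, magDensity, hy]
  congr 1
  refine lintegral_congr_ae ?_
  filter_upwards [h] with z hz
  simp only [magDiff, hy, hz]

lemma energyDensity_comp (hiso : MagIsometryCondition A) (g : E3 ≃ₗᵢ[ℝ] E3) (y : E3) :
    energyDensity A s m (fun z => u (g z)) y = energyDensity A s m u (g y) := by
  simp only [energyDensity, magDensity, magDiff_comp hiso]
  congr 1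
  rw [← g.measurePreserving.lintegral_comp_emb (measurableEmbedding_isometry g)
    (fun z => ‖magDiff A u (g y) z‖ₑ ^ 2 * ENNReal.ofReal (pseudorelKernel s m (g y - z)))]
  refine lintegral_congr fun z => ?_
  rw [← map_sub, pseudorelKernel_map]

lemma lintegral_ball_energyDensity (hiso : MagIsometryCondition A) (hu : IsRadialAE u)
    (g : E3 ≃ₗᵢ[ℝ] E3) (x : E3) (r : ℝ) :
    ∫⁻ y in Metric.ball (g x) r, energyDensity A s m u y
      = ∫⁻ y in Metric.ball x r, energyDensity A s m u y := by
  have hpre : g ⁻¹' Metric.ball (g x) r = Metric.ball x r := by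
    ext y; simp
  rw [← g.measurePreserving.setLIntegral_comp_preimage_emb (measurableEmbedding_isometry g), hpre]
  refine lintegral_congr_ae (ae_restrict_of_ae ?_)
  filter_upwards [energyDensity_congr_ae (A := A) (s := s) (m := m) (hu g)] with y hy
  rw [← energyDensity_comp hiso, hy]

/-- The reflection across the hyperplane orthogonal to `x - y` exchanges two vectors of equal norm.
-/
lemma exists_isometry_map {x y : E3} (h : ‖x‖ = ‖y‖) : ∃ g : E3 ≃ₗᵢ[ℝ] E3, g x = y :=
  ⟨_, Submodule.reflection_sub h⟩

lemma infinite_unitSphere : (Metric.sphere (0 : E3) 1).Infinite := by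
  have hrank : 1 < Module.rank ℝ E3 := by
    rw [← Module.finrank_eq_rank]; simp
  refine (isConnected_sphere hrank (0 : E3) zero_le_one).isPreconnected.infinite_of_nontrivial ?_
  obtain ⟨x, hx⟩ := (NormedSpace.sphere_nonempty (x := (0 : E3)) (r := 1)).2 zero_le_one
  refine ⟨x, hx, -x, by simpa using hx, fun h => ?_⟩
  have h0 : x = 0 := by
    rw [eq_neg_iff_add_eq_zero, ← two_smul ℝ, smul_eq_zero] at h
    exact h.resolve_left two_ne_zero
  simp [h0] at hx

/-- The energy of a radial function on unit balls far from the origin is a small part of the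
total energy. -/
lemma exists_radius_energy_ball (hiso : MagIsometryCondition A) (N : ℕ) :
    ∃ R : ℝ, ∀ x : E3, R ≤ ‖x‖ → ∀ u : E3 → ℂ, IsRadialAE u →
      N * ∫⁻ y in Metric.ball x 1, energyDensity A s m u y ≤ ∫⁻ y, energyDensity A s m u y := by
  obtain ⟨t, ht, htN⟩ := infinite_unitSphere.exists_subset_card_eq N
  -- Scaling `N` fixed directions by a large `ρ` separates them by at least `2`, so the unit balls
  -- around them are disjoint.
  have hev : ∀ᶠ ρ : ℝ in atTop, ∀ a ∈ t, ∀ b ∈ t, a ≠ b → 2 ≤ ρ * dist a b := by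
    refine (Filter.eventually_all_finset t).2 fun a _ => (Filter.eventually_all_finset t).2
      fun b _ => ?_
    rcases eq_or_ne a b with rfl | hab
    · simp
    · filter_upwards [(tendsto_id.atTop_mul_const (dist_pos.2 hab)).eventually_ge_atTop 2]
        with ρ hρ _ using hρ
  obtain ⟨R, hR⟩ := (hev.and (eventually_ge_atTop 0)).exists_forall_of_atTop
  refine ⟨R, fun x hx u hu => ?_⟩
  obtain ⟨hsep, hx0⟩ := hR ‖x‖ hx
  have hdisj : Set.PairwiseDisjoint (t : Set E3) fun a => Metric.ball (‖x‖ • a) 1 := by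
    intro a ha b hb hab
    refine Metric.ball_disjoint_ball ?_
    rw [dist_smul₀, Real.norm_of_nonneg hx0]
    linarith [hsep a ha b hb hab]
  calc N * ∫⁻ y in Metric.ball x 1, energyDensity A s m u y
      = ∑ a ∈ t, ∫⁻ y in Metric.ball (‖x‖ • a) 1, energyDensity A s m u y := by
        rw [← htN, ← nsmul_eq_mul, ← Finset.sum_const]
        refine Finset.sum_congr rfl fun a ha => ?_
        have ha1 : ‖a‖ = 1 := by simpa using ht ha
        obtain ⟨g, hg⟩ := exists_isometry_map (x := x) (y := ‖x‖ • a)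
          (by rw [norm_smul, ha1]; simp)
        rw [← hg, lintegral_ball_energyDensity hiso hu]
    _ = ∫⁻ y in ⋃ a ∈ t, Metric.ball (‖x‖ • a) 1, energyDensity A s m u y :=
        (lintegral_biUnion_finset hdisj (fun _ _ => measurableSet_ball) _).symm
    _ ≤ _ := setLIntegral_le_lintegral _ _

/-- Uniform decay of radial functions at infinity, in `L^p`. -/
lemma exists_radius_lintegral_rpow_le (hs : 0 < s) (hs1 : s < 1) (hm : 0 < m) (hp2 : 2 < p)
    (hp : p ≤ 6 / (3 - 2 * s)) (hA : Continuous A) (hiso : MagIsometryCondition A)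
    {T ε : ℝ} (hT : 0 < T) (hε : 0 < ε) :
    ∃ R : ℝ, ∀ (u : E3 → ℂ) (U : MagSpace), MagRepr A s m u U → IsRadialAE u → ‖U‖ ≤ T →
      ∫⁻ x in (Metric.ball 0 R)ᶜ, ‖u x‖ₑ ^ p ≤ ENNReal.ofReal ε := by
  obtain ⟨K, hK, hE⟩ := exists_lintegral_energyDensity_le hs hs1 hm
  obtain ⟨C, hC, h⟩ := exists_enorm_rpow_le hs hs1 hm hp2 hp
  have hlim : Tendsto (fun M : ℝ => C * M ^ (p - 2) * (K * T ^ 2)) (𝓝[>] 0) (𝓝 0) := by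
    have h1 : Tendsto (fun M : ℝ => M ^ (p - 2)) (𝓝[>] 0) (𝓝 0) := by
      have := (Real.continuousAt_rpow_const 0 (p - 2) (Or.inr (by linarith))).tendsto
      rw [Real.zero_rpow (by linarith)] at this
      exact this.mono_left nhdsWithin_le_nhds
    simpa using (h1.const_mul C).mul_const (K * T ^ 2)
  -- The factor `M^(p-2)` tends to zero with `M` because `p > 2`. Then `N > K T² / M²` disjoint
  -- copies force the energy of a far unit ball below `M²`.
  obtain ⟨M, hM1, hM0⟩ := ((hlim.eventually_le_const hε).and self_mem_nhdsWithin).exists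
  have hM0 : 0 < M := hM0
  obtain ⟨N, hN⟩ := exists_nat_gt (K * T ^ 2 / M ^ 2)
  have hN0 : (0 : ℝ) < N := lt_of_le_of_lt (by positivity) hN
  obtain ⟨R, hR⟩ := exists_radius_energy_ball (A := A) (s := s) (m := m) hiso N
  refine ⟨R, fun u U hU hrad hUT => ?_⟩
  have hE' : ∫⁻ y, energyDensity A s m u y ≤ ENNReal.ofReal (K * T ^ 2) :=
    (hE A hA u U hU).trans (ENNReal.ofReal_le_ofReal (by gcongr))
  have hball : ∀ x : E3, R ≤ ‖x‖ →
      ∫⁻ y in Metric.ball x 1, energyDensity A s m u y ≤ ENNReal.ofReal (M ^ 2) := by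
    intro x hx
    have h1 := (hR x hx u hrad).trans hE'
    have h2 : ENNReal.ofReal (K * T ^ 2) ≤ N * ENNReal.ofReal (M ^ 2) := by
      rw [← ENNReal.ofReal_natCast, ← ENNReal.ofReal_mul hN0.le]
      refine ENNReal.ofReal_le_ofReal ?_
      rw [div_lt_iff₀ (by positivity)] at hN
      exact hN.le
    exact (ENNReal.mul_le_mul_iff_right (by exact_mod_cast hN0.ne') (ENNReal.natCast_ne_top N)).1
      (h1.trans h2)
  calc ∫⁻ x in (Metric.ball 0 R)ᶜ, ‖u x‖ₑ ^ p
      ≤ ∫⁻ x in (Metric.ball 0 R)ᶜ, ENNReal.ofReal (C * M ^ (p - 2)) * energyDensity A s m u x := by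
        refine setLIntegral_mono' measurableSet_ball.compl fun x hx => ?_
        exact h A hA u (hU.memLp hm).1 x M hM0 (hball x (by simpa using hx))
    _ ≤ ENNReal.ofReal (C * M ^ (p - 2)) * ENNReal.ofReal (K * T ^ 2) := by
        rw [lintegral_const_mul' _ _ ENNReal.ofReal_ne_top]
        gcongr
        exact (setLIntegral_le_lintegral _ _).trans hE'
    _ ≤ _ := by
        rw [← ENNReal.ofReal_mul (by positivity)]
        exact ENNReal.ofReal_le_ofReal hM1

/-! ### Magnetic averages and local compactness -/

/-- The phase `exp(i (x - z) · A((x + z)/2))`. -/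
def magPhase (A : E3 → E3) (x z : E3) : ℂ :=
  Complex.exp (Complex.I * ((inner ℝ (x - z) (A ((2 : ℝ)⁻¹ • (x + z))) : ℝ) : ℂ))

lemma norm_magPhase_eq (x z : E3) : ‖magPhase A x z‖ = 1 := by
  rw [magPhase, Complex.norm_exp]; simp

lemma continuous_magPhase' (hA : Continuous A) :
    Continuous fun q : E3 × E3 => magPhase A q.1 q.2 := by
  unfold magPhase; fun_prop

lemma continuous_magPhase_right (hA : Continuous A) (x : E3) :
    Continuous fun z => magPhase A x z := by
  unfold magPhase; fun_prop

/-- Undoing the phase on `u(x)` moves it onto `u(z)`. The magnetic average is therefore the right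
approximation of `u(x)`: its error is a mean of magnetic differences, which the energy controls. -/
lemma magPhase_mul_magDiff (x z : E3) :
    magPhase A x z * magDiff A u x z = u x - magPhase A x z * u z := by
  have h : magPhase A x z *
      Complex.exp (-Complex.I * ((inner ℝ (x - z) (A ((2 : ℝ)⁻¹ • (x + z))) : ℝ) : ℂ)) = 1 := by
    rw [magPhase, ← Complex.exp_add]; simp
  rw [magDiff, mul_sub, ← mul_assoc, h, one_mul]

/-- The magnetic average of `u` over the ball `B(x, r)`. -/
def magAvg (A : E3 → E3) (r : ℝ) (u : E3 → ℂ) (x : E3) : ℂ :=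
  ∫ z, magPhase A x z * u z ∂ballMeasure x r

/-- The integral kernel of the magnetic average. -/
def magAvgKernel (A : E3 → E3) (r : ℝ) (x z : E3) : ℂ :=
  (((volume (Metric.ball (0 : E3) r))⁻¹).toReal : ℂ) *
    (Metric.ball x r).indicator (magPhase A x) z

lemma magAvg_eq (r : ℝ) (x : E3) : magAvg A r u x = ∫ z, magAvgKernel A r x z * u z := by
  rw [magAvg, ballMeasure, integral_smul_measure, Measure.addHaar_ball_center,
    ← integral_indicator measurableSet_ball, Complex.real_smul, ← integral_const_mul]
  refine integral_congr_ae (ae_of_all _ fun z => ?_)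
  simp only [magAvgKernel]
  by_cases hz : z ∈ Metric.ball x r
  · rw [indicator_of_mem hz, indicator_of_mem hz, mul_assoc]
  · rw [indicator_of_notMem hz, indicator_of_notMem hz]; simp

lemma measurable_magAvgKernel (hA : Continuous A) (r : ℝ) :
    Measurable fun q : E3 × E3 => magAvgKernel A r q.1 q.2 := by
  refine Measurable.const_mul ?_ _
  have hS : MeasurableSet {q : E3 × E3 | q.2 ∈ Metric.ball q.1 r} := by
    simp only [Metric.mem_ball]
    exact measurableSet_lt (measurable_snd.dist measurable_fst) measurable_const
  exact ((continuous_magPhase' hA).measurable.indicator hS)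

lemma aestronglyMeasurable_magAvg (hA : Continuous A) (hu : AEStronglyMeasurable u) (r : ℝ) :
    AEStronglyMeasurable (magAvg A r u) := by
  have h : magAvg A r u = fun x => ∫ z, magAvgKernel A r x z * u z := funext fun x => magAvg_eq r x
  rw [h]
  exact AEStronglyMeasurable.integral_prod_right'
    ((measurable_magAvgKernel hA r).aestronglyMeasurable.mul hu.comp_snd)

lemma memLp_magAvgKernel (hA : Continuous A) (r : ℝ) (x : E3) :
    MemLp (magAvgKernel A r x) 2 := by
  refine MemLp.const_mul ?_ _
  rw [memLp_indicator_iff_restrict measurableSet_ball]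
  have : IsFiniteMeasure (volume.restrict (Metric.ball x r)) :=
    ⟨by rw [Measure.restrict_apply_univ]; exact measure_ball_lt_top⟩
  refine MemLp.of_bound ?_ 1 (ae_of_all _ fun z => (norm_magPhase_eq x z).le)
  exact (continuous_magPhase_right hA x).aestronglyMeasurable

lemma enorm_magAvg_le (r : ℝ) (x : E3) : ‖magAvg A r u x‖ₑ ≤ ∫⁻ z, ‖u z‖ₑ ∂ballMeasure x r := by
  refine (enorm_integral_le_lintegral_enorm _).trans (lintegral_mono fun z => ?_)
  rw [enorm_mul, ← ofReal_norm (magPhase A x z), norm_magPhase_eq]; simp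

lemma integrable_ballMeasure {f : E3 → ℂ} (hu : MemLp f 2) (x : E3) {r : ℝ} (hr : 0 < r) :
    Integrable f (ballMeasure x r) := by
  have := isProbabilityMeasure_ballMeasure x hr
  have hc : (volume (Metric.ball x r))⁻¹ ≠ ⊤ :=
    ENNReal.inv_ne_top.2 (Metric.measure_ball_pos _ _ hr).ne'
  have h1 : MemLp f 2 (ballMeasure x r) := by
    rw [ballMeasure]
    exact (hu.restrict (Metric.ball x r)).smul_measure hc
  exact h1.integrable one_le_two

lemma enorm_sq_le_magAvg (hA : Continuous A) (hu : MemLp u 2) (x : E3) {r : ℝ} (hr : 0 < r) :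
    ‖u x‖ₑ ^ 2 ≤ 2 * ‖magAvg A r u x‖ₑ ^ 2 +
      2 * ∫⁻ z, ‖magDiff A u x z‖ₑ ^ 2 ∂ballMeasure x r := by
  have := isProbabilityMeasure_ballMeasure x hr
  have hph := continuous_magPhase_right hA x
  have hi : Integrable (fun z => magPhase A x z * u z) (ballMeasure x r) :=
    (integrable_ballMeasure hu x hr).bdd_mul (c := 1) hph.aestronglyMeasurable
      (ae_of_all _ fun z => (norm_magPhase_eq x z).le)
  have h1 : u x = magAvg A r u x + ∫ z, magPhase A x z * magDiff A u x z ∂ballMeasure x r := by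
    simp_rw [magPhase_mul_magDiff]
    rw [integral_sub (integrable_const _) hi, magAvg]
    simp
  have h2 : ‖u x‖ₑ ≤ ‖magAvg A r u x‖ₑ + ∫⁻ z, ‖magDiff A u x z‖ₑ ∂ballMeasure x r := by
    calc ‖u x‖ₑ ≤ ‖magAvg A r u x‖ₑ +
          ‖∫ z, magPhase A x z * magDiff A u x z ∂ballMeasure x r‖ₑ := by
          conv_lhs => rw [h1]
          exact enorm_add_le _ _
      _ ≤ _ := by
          gcongr
          refine (enorm_integral_le_lintegral_enorm _).trans (lintegral_mono fun z => ?_)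
          rw [enorm_mul, ← ofReal_norm (magPhase A x z), norm_magPhase_eq]; simp
  have h3 := sq_lintegral_le ((aestronglyMeasurable_magDiff_right hA hu.1 x).enorm.mono_ac
    (ballMeasure_absolutelyContinuous x r))
  have h4 : ∀ a b : ENNReal, (a + b) ^ 2 ≤ 2 * a ^ 2 + 2 * b ^ 2 := by
    intro a b
    have := ENNReal.rpow_add_le_mul_rpow_add_rpow a b (p := 2) (by norm_num)
    norm_num at this
    rwa [← mul_add]
  calc ‖u x‖ₑ ^ 2 ≤ (‖magAvg A r u x‖ₑ + ∫⁻ z, ‖magDiff A u x z‖ₑ ∂ballMeasure x r) ^ 2 := by gcongr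
    _ ≤ _ := (h4 _ _).trans (by gcongr)

/-- Local compactness: weakly null bounded sequences are locally strongly null in `L²`. -/
lemma tendsto_lintegral_ball_of_weak (hs : 0 < s) (hs1 : s < 1) (hm : 0 < m) (hA : Continuous A)
    {f : ℕ → E3 → ℂ} {F : ℕ → MagSpace} (hF : ∀ n, MagRepr A s m (f n) (F n)) {T : ℝ}
    (hT : ∀ n, ‖F n‖ ≤ T) (hw : ∀ W : MagSpace, Tendsto (fun n => inner ℂ W (F n)) atTop (𝓝 0))
    (R : ℝ) {ε : ℝ} (hε : 0 < ε) :
    ∀ᶠ n in atTop, ∫⁻ x in Metric.ball 0 R, ‖f n x‖ₑ ^ 2 ≤ ENNReal.ofReal ε := by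
  obtain ⟨K, hK, hE⟩ := exists_lintegral_energyDensity_le hs hs1 hm
  obtain ⟨C, hC, h⟩ := exists_lintegral_sq_magDiff_le hs hm
  obtain ⟨v, hv, hb⟩ := exists_lintegral_ballMeasure_eq
  have hT0 : 0 ≤ T := (norm_nonneg _).trans (hT 0)
  have hmem : ∀ n, MemLp (f n) 2 := fun n => (hF n).memLp hm
  have hE' : ∀ n, ∫⁻ y, energyDensity A s m (f n) y ≤ ENNReal.ofReal (K * T ^ 2) := fun n =>
    (hE A hA _ _ (hF n)).trans (ENNReal.ofReal_le_ofReal (by gcongr; exact hT n))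
  -- The radius makes the error between `u` and its magnetic average at most `ε/2` uniformly in `n`.
  -- The averages themselves then only need to be small for this fixed `r`.
  obtain ⟨r, hr, hr0, hr1⟩ : ∃ r : ℝ, 2 * (C * r ^ (2 * s)) * (K * T ^ 2) ≤ ε / 2 ∧ 0 < r ∧
      r ≤ 1 := by
    have h1 : Tendsto (fun r : ℝ => 2 * (C * r ^ (2 * s)) * (K * T ^ 2)) (𝓝[>] 0) (𝓝 0) := by
      have := (Real.continuousAt_rpow_const 0 (2 * s) (Or.inr (by positivity))).tendsto
      rw [Real.zero_rpow (by positivity)] at this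
      simpa using ((((this.mono_left nhdsWithin_le_nhds).const_mul C).const_mul 2).mul_const
        (K * T ^ 2))
    obtain ⟨r, h2, h3⟩ := ((h1.eventually_le_const (half_pos hε)).and
      (Ioc_mem_nhdsGT (zero_lt_one' ℝ))).exists
    exact ⟨r, h2, h3.1, h3.2⟩
  have hms : 0 < m ^ s := Real.rpow_pos_of_pos hm s
  have hpt : ∀ x, Tendsto (fun n => magAvg A r (f n) x) atTop (𝓝 0) := by
    intro x
    -- Evaluating the magnetic average at `x` is, up to the factor `m^s`, the inner product with
    -- this vector. Weak convergence thus gives pointwise convergence of the averages.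
    set W : MagSpace := WithLp.toLp 2 (0, (memLp_magAvgKernel hA r x).star.toLp) with hW
    have h1 : ∀ n, inner ℂ W (F n) = ((m ^ s : ℝ) : ℂ) * magAvg A r (f n) x := by
      intro n
      have h2 : inner ℂ W (F n) = inner ℂ W.fst (F n).fst + inner ℂ W.snd (F n).snd :=
        WithLp.prod_inner_apply _ _
      rw [h2, show W.fst = 0 from rfl, inner_zero_left, zero_add, L2.inner_def, magAvg_eq,
        ← integral_const_mul]
      refine integral_congr_ae ?_
      filter_upwards [(hF n).2, (memLp_magAvgKernel hA r x).star.coeFn_toLp] with z h3 h4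
      rw [RCLike.inner_apply, h3, show W.snd z = star (magAvgKernel A r x) z from h4]
      simp only [Pi.star_apply, RCLike.star_def, Complex.conj_conj]
      ring
    have h2 := (hw W).const_mul (((m ^ s : ℝ) : ℂ)⁻¹)
    simp_rw [h1] at h2
    rw [mul_zero] at h2
    refine h2.congr fun n => ?_
    rw [inv_mul_cancel_left₀ (by exact_mod_cast hms.ne')]
  -- Jensen and the energy bound dominate the averages by a constant, which is integrable on the
  -- ball.
  have hdct : Tendsto (fun n => ∫⁻ x in Metric.ball 0 R, ‖magAvg A r (f n) x‖ₑ ^ 2) atTop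
      (𝓝 (∫⁻ x in Metric.ball (0 : E3) R, 0)) := by
    refine tendsto_lintegral_of_dominated_convergence'
      (fun _ => ENNReal.ofReal (v * r⁻¹ ^ 3) * ENNReal.ofReal (K * T ^ 2)) (fun n => ?_)
      (fun n => ae_of_all _ fun x => ?_) ?_ (ae_of_all _ fun x => ?_)
    · exact ((aestronglyMeasurable_magAvg hA (hmem n).1 r).enorm.pow_const 2).restrict
    · have := isProbabilityMeasure_ballMeasure x hr0
      calc ‖magAvg A r (f n) x‖ₑ ^ 2 ≤ (∫⁻ z, ‖f n z‖ₑ ∂ballMeasure x r) ^ 2 := by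
            exact pow_le_pow_left' (enorm_magAvg_le r x) 2
        _ ≤ ∫⁻ z, ‖f n z‖ₑ ^ 2 ∂ballMeasure x r := sq_lintegral_le
            ((hmem n).1.enorm.mono_ac (ballMeasure_absolutelyContinuous x r))
        _ ≤ _ := by
            rw [hb x r hr0]
            beta_reduce
            gcongr
            exact (setLIntegral_le_lintegral _ _).trans
              ((lintegral_mono fun y => le_self_add).trans (hE' n))
    · rw [lintegral_const, Measure.restrict_apply_univ]
      exact ENNReal.mul_ne_top (ENNReal.mul_ne_top ENNReal.ofReal_ne_top ENNReal.ofReal_ne_top)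
        measure_ball_lt_top.ne
    · have h1 := (continuous_enorm.tendsto (0 : ℂ)).comp (hpt x)
      have h2 := ((ENNReal.continuous_pow 2).tendsto _).comp h1
      simpa [Function.comp_def] using h2
  rw [lintegral_zero] at hdct
  have hev := hdct.eventually_le_const (u := ENNReal.ofReal (ε / 4)) (by simpa using hε)
  filter_upwards [hev] with n hn
  calc ∫⁻ x in Metric.ball 0 R, ‖f n x‖ₑ ^ 2
      ≤ ∫⁻ x in Metric.ball 0 R, (2 * ‖magAvg A r (f n) x‖ₑ ^ 2 +
          2 * (ENNReal.ofReal (C * r ^ (2 * s)) * magDensity A s m (f n) x)) := by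
        refine lintegral_mono fun x => (enorm_sq_le_magAvg hA (hmem n) x hr0).trans ?_
        gcongr
        exact h A (f n) x x r hr0 hr1 (Metric.mem_ball_self hr0)
    _ = 2 * (∫⁻ x in Metric.ball 0 R, ‖magAvg A r (f n) x‖ₑ ^ 2) +
          2 * (ENNReal.ofReal (C * r ^ (2 * s)) *
            ∫⁻ x in Metric.ball 0 R, magDensity A s m (f n) x) := by
        rw [lintegral_add_left', lintegral_const_mul' _ _ (by norm_num),
          lintegral_const_mul' _ _ (by norm_num), lintegral_const_mul' _ _ ENNReal.ofReal_ne_top]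
        exact ((aestronglyMeasurable_magAvg hA (hmem n).1 r).enorm.pow_const 2).restrict.const_mul _
    _ ≤ 2 * ENNReal.ofReal (ε / 4) + 2 * (ENNReal.ofReal (C * r ^ (2 * s)) *
          ENNReal.ofReal (K * T ^ 2)) := by
        gcongr
        exact (setLIntegral_le_lintegral _ _).trans
          ((lintegral_mono fun y => le_add_self).trans (hE' n))
    _ = ENNReal.ofReal (2 * (ε / 4) + 2 * (C * r ^ (2 * s)) * (K * T ^ 2)) := by
        have h2 : (2 : ENNReal) = ENNReal.ofReal 2 := by norm_num
        rw [h2, ← ENNReal.ofReal_mul (by norm_num), ← ENNReal.ofReal_mul (by positivity),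
          ← ENNReal.ofReal_mul (by norm_num), ← ENNReal.ofReal_add (by positivity) (by positivity),
          mul_assoc 2 (C * r ^ (2 * s))]
    _ ≤ _ := ENNReal.ofReal_le_ofReal (by linarith)

/-! ### Compact embedding of the radial space in `L^p` -/

/-- Where `‖z‖ ≤ l` the quadratic term dominates, elsewhere the `q`-th power does. The free level
`l` later makes the critical term small. -/
lemma ENNReal.rpow_le_interpolate {q l : ℝ} (hp2 : 2 ≤ p) (hpq : p ≤ q) (hl : 0 < l) (z : ℂ) :
    ‖z‖ₑ ^ p ≤
      ENNReal.ofReal (l ^ (p - 2)) * ‖z‖ₑ ^ 2 + ENNReal.ofReal (l ^ (p - q)) * ‖z‖ₑ ^ q := by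
  have h : ‖z‖ ^ p ≤ l ^ (p - 2) * ‖z‖ ^ 2 + l ^ (p - q) * ‖z‖ ^ q := by
    rcases (norm_nonneg z).eq_or_lt with h0 | h0
    · rw [← h0, Real.zero_rpow (by linarith), Real.zero_rpow (by linarith)]; simp
    rcases le_total ‖z‖ l with h1 | h1
    · have h2 : ‖z‖ ^ p = ‖z‖ ^ (p - 2) * ‖z‖ ^ 2 := by
        rw [← Real.rpow_natCast, ← Real.rpow_add h0]; norm_num
      rw [h2]
      have : ‖z‖ ^ (p - 2) ≤ l ^ (p - 2) := Real.rpow_le_rpow h0.le h1 (by linarith)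
      have h3 : ‖z‖ ^ (p - 2) * ‖z‖ ^ 2 ≤ l ^ (p - 2) * ‖z‖ ^ 2 := by gcongr
      have h4 : 0 ≤ l ^ (p - q) * ‖z‖ ^ q := by positivity
      linarith
    · have h2 : ‖z‖ ^ p = ‖z‖ ^ (p - q) * ‖z‖ ^ q := by
        rw [← Real.rpow_add h0]; ring_nf
      rw [h2]
      have : ‖z‖ ^ (p - q) ≤ l ^ (p - q) := Real.rpow_le_rpow_of_nonpos hl h1 (by linarith)
      have h3 : ‖z‖ ^ (p - q) * ‖z‖ ^ q ≤ l ^ (p - q) * ‖z‖ ^ q := by gcongr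
      have h4 : 0 ≤ l ^ (p - 2) * ‖z‖ ^ 2 := by positivity
      linarith
  rw [← ofReal_norm, ENNReal.ofReal_rpow_of_nonneg (norm_nonneg _) (by linarith),
    ENNReal.ofReal_rpow_of_nonneg (norm_nonneg _) (by linarith),
    ← ENNReal.ofReal_pow (norm_nonneg _), ← ENNReal.ofReal_mul (by positivity),
    ← ENNReal.ofReal_mul (by positivity), ← ENNReal.ofReal_add (by positivity) (by positivity)]
  exact ENNReal.ofReal_le_ofReal h

/-- Compactness of the embedding of the radial space in `L^p`: weakly null sequences of radial
functions are strongly null in `L^p`. -/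
lemma tendsto_lintegral_rpow_of_weak (hs : 0 < s) (hs1 : s < 1) (hm : 0 < m) (hp2 : 2 < p)
    (hp : p < 6 / (3 - 2 * s)) (hA : Continuous A) (hiso : MagIsometryCondition A)
    {f : ℕ → E3 → ℂ} {F : ℕ → MagSpace} (hF : ∀ n, MagRepr A s m (f n) (F n))
    (hrad : ∀ n, IsRadialAE (f n)) {T : ℝ} (hT : ∀ n, ‖F n‖ ≤ T)
    (hw : ∀ W : MagSpace, Tendsto (fun n => inner ℂ W (F n)) atTop (𝓝 0)) :
    ∀ ε : ℝ, 0 < ε → ∀ᶠ n in atTop, ∫⁻ x, ‖f n x‖ₑ ^ p ≤ ENNReal.ofReal ε := by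
  intro ε hε
  set q := 6 / (3 - 2 * s) with hq
  obtain ⟨S, hS, hSob⟩ := exists_lintegral_rpow_le hs hs1 hm (hp2.trans hp) le_rfl
  -- The decay lemma needs a strictly positive norm bound, and `T` may be zero.
  have hT1 : ∀ n, ‖F n‖ ≤ max T 1 := fun n => (hT n).trans (le_max_left _ _)
  have hT0 : 0 < max T 1 := lt_max_of_lt_right one_pos
  obtain ⟨R, hR⟩ := exists_radius_lintegral_rpow_le hs hs1 hm hp2 hp.le hA hiso hT0
    (show 0 < ε / 3 by positivity)
  -- Strict subcriticality is used here: `l^(p-q)` tends to zero as `l → ∞`, while the critical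
  -- Sobolev bound stays fixed. The local `L²` tolerance is fixed afterwards, in terms of `l`.
  obtain ⟨l, hl, hl0⟩ : ∃ l : ℝ, l ^ (p - q) * (S * max T 1 ^ q) ≤ ε / 3 ∧ 0 < l := by
    have h1 : Tendsto (fun l : ℝ => l ^ (p - q) * (S * max T 1 ^ q)) atTop (𝓝 0) := by
      have := (tendsto_rpow_neg_atTop (y := q - p) (by linarith)).mul_const (S * max T 1 ^ q)
      simpa using this
    exact ((h1.eventually_le_const (show 0 < ε / 3 by positivity)).and
      (eventually_gt_atTop 0)).exists
  have hloc := tendsto_lintegral_ball_of_weak hs hs1 hm hA hF hT hw R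
    (show 0 < ε / 3 / l ^ (p - 2) by positivity)
  filter_upwards [hloc] with n hn
  have hm' := (hF n).memLp hm
  rw [← lintegral_add_compl _ (measurableSet_ball (x := (0 : E3)) (ε := R))]
  calc (∫⁻ x in Metric.ball 0 R, ‖f n x‖ₑ ^ p) + ∫⁻ x in (Metric.ball 0 R)ᶜ, ‖f n x‖ₑ ^ p
      ≤ (ENNReal.ofReal (l ^ (p - 2)) * ENNReal.ofReal (ε / 3 / l ^ (p - 2)) +
        ENNReal.ofReal (l ^ (p - q)) * ENNReal.ofReal (S * max T 1 ^ q)) +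
          ENNReal.ofReal (ε / 3) := by
        refine add_le_add ?_ (hR _ _ (hF n) (hrad n) (hT1 n))
        calc ∫⁻ x in Metric.ball 0 R, ‖f n x‖ₑ ^ p
            ≤ ∫⁻ x in Metric.ball 0 R, (ENNReal.ofReal (l ^ (p - 2)) * ‖f n x‖ₑ ^ 2 +
                ENNReal.ofReal (l ^ (p - q)) * ‖f n x‖ₑ ^ q) :=
              lintegral_mono fun x => ENNReal.rpow_le_interpolate hp2.le hp.le hl0 _
          _ = ENNReal.ofReal (l ^ (p - 2)) * (∫⁻ x in Metric.ball 0 R, ‖f n x‖ₑ ^ 2) +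
                ENNReal.ofReal (l ^ (p - q)) * ∫⁻ x in Metric.ball 0 R, ‖f n x‖ₑ ^ q := by
              rw [lintegral_add_left', lintegral_const_mul' _ _ ENNReal.ofReal_ne_top,
                lintegral_const_mul' _ _ ENNReal.ofReal_ne_top]
              exact (hm'.1.enorm.pow_const 2).restrict.const_mul _
          _ ≤ _ := by
              gcongr
              refine (setLIntegral_le_lintegral _ _).trans ((hSob A hA _ _ (hF n)).trans ?_)
              have hq0 : 0 ≤ q := by linarith
              gcongr
              exact hT1 n
    _ = ENNReal.ofReal (ε / 3 + l ^ (p - q) * (S * max T 1 ^ q) + ε / 3) := by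
        rw [← ENNReal.ofReal_mul (by positivity), ← ENNReal.ofReal_mul (by positivity),
          ← ENNReal.ofReal_add (by positivity) (by positivity),
          ← ENNReal.ofReal_add (by positivity) (by positivity),
          mul_div_cancel₀ _ (by positivity)]
    _ ≤ _ := ENNReal.ofReal_le_ofReal (by linarith)

/-! ### Test functions have finite energy -/

/-- In polar coordinates the integrand is `r^(1-2s)` near `0` and `r^(-1-2s)` at infinity. These are
integrable because `s < 1` and `s > 0` respectively. -/
lemma integrable_min_mul_rpow (hs : 0 < s) (hs1 : s < 1) :
    Integrable fun z : E3 => min 1 (‖z‖ ^ 2) * ‖z‖ ^ (-(3 + 2 * s)) := by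
  have h := integrable_fun_norm_addHaar (volume : Measure E3)
    (f := fun r : ℝ => min 1 (r ^ 2) * r ^ (-(3 + 2 * s)))
  refine h.2 ?_
  rw [← Ioc_union_Ioi_eq_Ioi zero_le_one]
  refine IntegrableOn.union ?_ ?_
  · have h1 : IntegrableOn (fun r : ℝ => r ^ (1 - 2 * s)) (Ioc 0 1) := by
      rw [← intervalIntegrable_iff_integrableOn_Ioc_of_le zero_le_one]
      exact intervalIntegral.intervalIntegrable_rpow' (by linarith)
    refine h1.congr_fun (fun r hr => ?_) measurableSet_Ioc
    simp only [finrank_euclideanSpace, Fintype.card_fin, smul_eq_mul]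
    rw [min_eq_right (pow_le_one₀ hr.1.le hr.2), ← mul_assoc, ← pow_add,
      ← Real.rpow_natCast, ← Real.rpow_add hr.1]
    congr 1; push_cast; ring
  · have h1 : IntegrableOn (fun r : ℝ => r ^ (-1 - 2 * s)) (Ioi 1) :=
      integrableOn_Ioi_rpow_of_lt (by linarith) one_pos
    refine h1.congr_fun (fun r hr => ?_) measurableSet_Ioi
    have hr : 1 < r := hr
    simp only [finrank_euclideanSpace, Fintype.card_fin, smul_eq_mul]
    rw [min_eq_left (one_le_pow₀ hr.le), one_mul,
      ← Real.rpow_natCast, ← Real.rpow_add (by linarith)]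
    congr 1; push_cast; ring

/-- Near the diagonal both `φ` and the phase vary at most linearly; far from it the difference is
bounded. The indicators record that one of the two points must lie in the support, so the energy
integrand is dominated by convolution integrands. -/
lemma exists_norm_magDiff_sq_le (hA : Continuous A) {φ : E3 → ℂ} (hφ : ContDiff ℝ ∞ φ)
    (hc : HasCompactSupport φ) : ∃ C : ℝ, 0 ≤ C ∧ ∀ x y : E3,
      ‖magDiff A φ x y‖ ^ 2 ≤ C * min 1 (‖x - y‖ ^ 2) *
        ((tsupport φ).indicator 1 x + (tsupport φ).indicator 1 y) := by
  obtain ⟨L, hL⟩ := hφ.lipschitzWith_of_hasCompactSupport hc (by simp)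
  obtain ⟨B, hB⟩ := hc.exists_bound_of_continuous hφ.continuous
  have hB0 : 0 ≤ B := (norm_nonneg _).trans (hB 0)
  obtain ⟨R, hR⟩ := hc.isBounded.subset_closedBall (0 : E3)
  -- If one point lies in the support and the other is within distance `1`, the midpoint where `A`
  -- is evaluated stays in the ball of radius `R + 1`.
  obtain ⟨a, ha⟩ := (isCompact_closedBall (0 : E3) (R + 1)).exists_bound_of_continuousOn
    hA.continuousOn
  have ha' : ∀ z ∈ Metric.closedBall (0 : E3) (R + 1), ‖A z‖ ≤ |a| := fun z hz =>
    (ha z hz).trans (le_abs_self a)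
  refine ⟨(|a| * B + L) ^ 2 + 4 * B ^ 2, by positivity, fun x y => ?_⟩
  by_cases hxy : x ∉ tsupport φ ∧ y ∉ tsupport φ
  · have hx := image_eq_zero_of_notMem_tsupport hxy.1
    have hy := image_eq_zero_of_notMem_tsupport hxy.2
    rw [magDiff, hx, hy, indicator_of_notMem hxy.1, indicator_of_notMem hxy.2]
    simp
  have hsupp : x ∈ tsupport φ ∨ y ∈ tsupport φ := by
    by_contra h
    exact hxy ⟨fun hx => h (Or.inl hx), fun hy => h (Or.inr hy)⟩
  have hone : (1 : ℝ) ≤ (tsupport φ).indicator 1 x + (tsupport φ).indicator 1 y := by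
    have h0 : ∀ z, (0 : ℝ) ≤ (tsupport φ).indicator 1 z :=
      fun z => indicator_nonneg (fun _ _ => zero_le_one) z
    rcases hsupp with h | h
    · have := h0 y
      rw [indicator_of_mem h, Pi.one_apply]; linarith
    · have := h0 x
      rw [indicator_of_mem h, Pi.one_apply]; linarith
  refine le_trans ?_ (le_mul_of_one_le_right (by positivity) hone)
  have hbig : ‖magDiff A φ x y‖ ≤ 2 * B := by
    rw [magDiff]
    refine (norm_sub_le _ _).trans ?_
    rw [norm_mul, norm_magPhase, one_mul]
    linarith [hB x, hB y]
  rcases le_total 1 ‖x - y‖ with h1 | h1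
  · rw [min_eq_left (one_le_pow₀ h1), mul_one]
    have : ‖magDiff A φ x y‖ ^ 2 ≤ (2 * B) ^ 2 := by gcongr
    nlinarith [sq_nonneg (|a| * B + L)]
  · rw [min_eq_right (pow_le_one₀ (norm_nonneg _) h1)]
    have hmid : (2 : ℝ)⁻¹ • (x + y) ∈ Metric.closedBall (0 : E3) (R + 1) := by
      rw [mem_closedBall_zero_iff]
      have key : ∀ z w : E3, ‖z‖ ≤ R → ‖w - z‖ ≤ 1 → ‖(2 : ℝ)⁻¹ • (z + w)‖ ≤ R + 1 := by
        intro z w hz hw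
        have h2 : (2 : ℝ)⁻¹ • (z + w) = z + (2 : ℝ)⁻¹ • (w - z) := by module
        rw [h2]
        refine (norm_add_le _ _).trans ?_
        rw [norm_smul, Real.norm_of_nonneg (by norm_num)]
        linarith
      rcases hsupp with h | h
      · exact key x y (by simpa using hR h) (by rwa [norm_sub_rev])
      · rw [add_comm]
        exact key y x (by simpa using hR h) h1
    have hθ : |(inner ℝ (x - y) (A ((2 : ℝ)⁻¹ • (x + y))) : ℝ)| ≤ ‖x - y‖ * |a| :=
      (abs_real_inner_le_norm _ _).trans (by gcongr; exact ha' _ hmid)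
    have hexp : ‖Complex.exp (-Complex.I * ((inner ℝ (x - y) (A ((2 : ℝ)⁻¹ • (x + y))) : ℝ) : ℂ))
        - 1‖ ≤ ‖x - y‖ * |a| := by
      have := Real.norm_exp_I_mul_ofReal_sub_one_le
        (x := -(inner ℝ (x - y) (A ((2 : ℝ)⁻¹ • (x + y))) : ℝ))
      rw [Real.norm_eq_abs, abs_neg] at this
      refine le_trans (le_of_eq ?_) (this.trans hθ)
      congr 3
      push_cast; ring
    have hsmall : ‖magDiff A φ x y‖ ≤ (|a| * B + L) * ‖x - y‖ := by
      have h2 : magDiff A φ x y = (Complex.exp (-Complex.I *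
          ((inner ℝ (x - y) (A ((2 : ℝ)⁻¹ • (x + y))) : ℝ) : ℂ)) - 1) * φ x + (φ x - φ y) := by
        rw [magDiff]; ring
      rw [h2]
      refine (norm_add_le _ _).trans ?_
      rw [norm_mul]
      have h3 := hL.norm_sub_le x y
      have h4 : ‖Complex.exp (-Complex.I * ((inner ℝ (x - y) (A ((2 : ℝ)⁻¹ • (x + y))) : ℝ) : ℂ))
        - 1‖ * ‖φ x‖ ≤ ‖x - y‖ * |a| * B := by gcongr; exact hB x
      linarith
    have : ‖magDiff A φ x y‖ ^ 2 ≤ ((|a| * B + L) * ‖x - y‖) ^ 2 := by gcongr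
    rw [mul_pow] at this
    nlinarith [mul_nonneg (sq_nonneg B) (sq_nonneg ‖x - y‖)]

/-- Test functions have finite magnetic energy. -/
lemma memMagH_of_contDiff (hs : 0 < s) (hs1 : s < 1) (hm : 0 < m) (hA : Continuous A)
    {φ : E3 → ℂ} (hφ : ContDiff ℝ ∞ φ) (hc : HasCompactSupport φ) : MemMagH A s m φ := by
  refine ⟨hφ.continuous.memLp_of_hasCompactSupport hc, ?_⟩
  obtain ⟨C, hC, hbd⟩ := exists_norm_magDiff_sq_le hA hφ hc
  obtain ⟨K, hK, hk⟩ := exists_pseudorelKernel_le hs hm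
  have hj := integrable_min_mul_rpow hs hs1
  have h1K : Integrable ((tsupport φ).indicator (1 : E3 → ℝ)) := by
    rw [integrable_indicator_iff (isClosed_tsupport φ).measurableSet]
    exact integrableOn_const (C := (1 : ℝ)) (hs := hc.measure_lt_top.ne)
  have hI2 := h1K.convolution_integrand (ContinuousLinearMap.mul ℝ ℝ) hj
  have hI1 := hI2.swap
  have hI := (hI1.add hI2).const_mul (C * K)
  have hmeas : AEStronglyMeasurable (gagliardoIntegrand A s m φ φ) := by
    have hD := aestronglyMeasurable_magDiff hA hφ.continuous.aestronglyMeasurable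
    have hk : Measurable fun q : E3 × E3 => pseudorelKernel s m (q.1 - q.2) :=
      (measurable_pseudorelKernel s m).comp (measurable_fst.sub measurable_snd)
    exact (hD.mul (Complex.continuous_conj.comp_aestronglyMeasurable hD)).mul
      (Complex.measurable_ofReal.comp hk).aestronglyMeasurable
  refine hI.mono' hmeas (ae_of_all _ fun q => ?_)
  have hk0 := pseudorelKernel_nonneg hs hm (q.1 - q.2)
  have hind : ∀ z, (0 : ℝ) ≤ (tsupport φ).indicator 1 z :=
    fun z => indicator_nonneg (fun _ _ => zero_le_one) z
  have hind1 := hind q.1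
  have hind2 := hind q.2
  rw [gagliardoIntegrand_self, Complex.norm_real, Real.norm_of_nonneg (by positivity)]
  calc ‖magDiff A φ q.1 q.2‖ ^ 2 * pseudorelKernel s m (q.1 - q.2)
      ≤ (C * min 1 (‖q.1 - q.2‖ ^ 2) *
        ((tsupport φ).indicator 1 q.1 + (tsupport φ).indicator 1 q.2)) *
          (K * ‖q.1 - q.2‖ ^ (-(3 + 2 * s))) := by
        gcongr
        · exact hbd q.1 q.2
        · exact hk _
    _ = _ := by
        simp only [Pi.add_apply, Function.comp_apply, Prod.fst_swap, Prod.snd_swap,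
          ContinuousLinearMap.mul_apply', norm_sub_rev q.2 q.1]
        ring

lemma memHsA_of_contDiff (hs : 0 < s) (hs1 : s < 1) (hm : 0 < m) (hA : Continuous A)
    {φ : E3 → ℂ} (hφ : ContDiff ℝ ∞ φ) (hc : HasCompactSupport φ) : MemHsA A s m φ := by
  obtain ⟨U, hU⟩ := (memMagH_iff_exists_magRepr hs hs1 hm hA).1
    (memMagH_of_contDiff hs hs1 hm hA hφ hc)
  exact (memHsA_iff hs hs1 hm hA).2
    ⟨U, Submodule.le_topologicalClosure _ ⟨φ, hφ, hc, hU⟩, hU⟩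

/-! ### The radial sphere and existence of a minimizer -/

lemma memHsARad_const_mul (hs : 0 < s) (hs1 : s < 1) (hm : 0 < m) (hA : Continuous A)
    (h : MemHsARad A s m u) (a : ℂ) : MemHsARad A s m (fun x => a * u x) := by
  obtain ⟨U, hU, hr⟩ := (memHsARad_iff hs hs1 hm hA).1 h
  exact (memHsARad_iff hs hs1 hm hA).2 ⟨_, Submodule.smul_mem _ a hU, hr.smul a⟩

lemma mem_radialSphere_normalize (hs : 0 < s) (hs1 : s < 1) (hm : 0 < m) (hA : Continuous A)
    (h : MemHsARad A s m u) {N : ℝ} (hN : 0 < N)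
    (hu : eLpNorm u (ENNReal.ofReal p) volume = ENNReal.ofReal N) :
    (fun x => ((N⁻¹ : ℝ) : ℂ) * u x) ∈ radialSphere A s m p := by
  refine ⟨memHsARad_const_mul hs hs1 hm hA h _, ?_⟩
  have h1 : (fun x => ((N⁻¹ : ℝ) : ℂ) * u x) = ((N⁻¹ : ℝ) : ℂ) • u := rfl
  rw [h1, eLpNorm_const_smul, hu, ← ofReal_norm, Complex.norm_real,
    Real.norm_of_nonneg (by positivity), ← ENNReal.ofReal_mul (by positivity),
    inv_mul_cancel₀ hN.ne', ENNReal.ofReal_one]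

lemma radialSphere_nonempty (hs : 0 < s) (hs1 : s < 1) (hm : 0 < m) (hA : Continuous A)
    (hp : 0 < p) : (radialSphere A s m p).Nonempty := by
  -- A radial bump equal to `1` for `‖x‖ ≤ 1` and `0` for `‖x‖² ≥ 2`. Using `‖x‖²` keeps it smooth
  -- at the origin.
  set φ : E3 → ℂ := fun x => ((Real.smoothTransition (2 - ‖x‖ ^ 2) : ℝ) : ℂ) with hφ
  have hsm : ContDiff ℝ ∞ φ := Complex.ofRealCLM.contDiff.comp
    (Real.smoothTransition.contDiff.comp (contDiff_const.sub (contDiff_norm_sq ℝ)))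
  have hc : HasCompactSupport φ := by
    refine HasCompactSupport.intro (isCompact_closedBall (0 : E3) 2) fun x hx => ?_
    have hx : 2 < ‖x‖ := by simpa using hx
    simp only [hφ]
    rw [Real.smoothTransition.zero_of_nonpos (by nlinarith)]; simp
  have hrad : MemHsARad A s m φ :=
    ⟨memHsA_of_contDiff hs hs1 hm hA hsm hc, fun g => ae_of_all _ fun x => by simp [hφ]⟩
  have hmem : MemLp φ (ENNReal.ofReal p) := hsm.continuous.memLp_of_hasCompactSupport hc
  have h0 : eLpNorm φ (ENNReal.ofReal p) volume ≠ 0 := by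
    rw [Ne, eLpNorm_eq_zero_iff hmem.1 (by simpa using hp)]
    intro h
    have h1 := (hsm.continuous.ae_eq_iff_eq volume (continuous_zero (X := E3) (M := ℂ))).1 h
    have h2 := congrFun h1 0
    simp only [hφ, norm_zero, Pi.zero_apply] at h2
    rw [Real.smoothTransition.one_of_one_le (by norm_num)] at h2
    simp at h2
  exact ⟨_, mem_radialSphere_normalize hs hs1 hm hA hrad
    (ENNReal.toReal_pos h0 hmem.2.ne) (ENNReal.ofReal_toReal hmem.2.ne).symm⟩

lemma eLpNorm_ofReal_eq (hp : 0 < p) :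
    eLpNorm u (ENNReal.ofReal p) volume = (∫⁻ x, ‖u x‖ₑ ^ p) ^ (1 / p) := by
  rw [eLpNorm_eq_lintegral_rpow_enorm_toReal (by simpa using hp) ENNReal.ofReal_ne_top,
    ENNReal.toReal_ofReal hp.le]

lemma MemHsA.memLp_rpow (hs : 0 < s) (hs1 : s < 1) (hm : 0 < m) (hA : Continuous A) (hp2 : 2 < p)
    (hp : p ≤ 6 / (3 - 2 * s)) (hu : MemHsA A s m u) : MemLp u (ENNReal.ofReal p) := by
  obtain ⟨C, -, hC⟩ := exists_lintegral_rpow_le hs hs1 hm hp2 hp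
  obtain ⟨U, -, hU⟩ := (memHsA_iff hs hs1 hm hA).1 hu
  refine ⟨hu.1.1.1, ?_⟩
  rw [eLpNorm_ofReal_eq (by linarith)]
  exact ENNReal.rpow_lt_top_of_nonneg (by positivity)
    ((hC A hA u U hU).trans_lt ENNReal.ofReal_lt_top).ne

lemma magNormSq_nonneg_of_mem (hs : 0 < s) (hs1 : s < 1) (hm : 0 < m) (hA : Continuous A)
    (h : MemHsARad A s m u) : 0 ≤ magNormSq A s m u := by
  obtain ⟨U, -, hU⟩ := (memHsARad_iff hs hs1 hm hA).1 h
  rw [magNormSq_eq_norm_sq hs hs1 hm hU]; positivity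

lemma bddBelow_magNormSq (hs : 0 < s) (hs1 : s < 1) (hm : 0 < m) (hA : Continuous A) :
    BddBelow (magNormSq A s m '' radialSphere A s m p) := by
  refine ⟨0, ?_⟩
  rintro _ ⟨u, hu, rfl⟩
  exact magNormSq_nonneg_of_mem hs hs1 hm hA hu.1

lemma radialInf_le (hs : 0 < s) (hs1 : s < 1) (hm : 0 < m) (hA : Continuous A)
    (hu : u ∈ radialSphere A s m p) : radialInf A s m p ≤ magNormSq A s m u :=
  csInf_le (bddBelow_magNormSq hs hs1 hm hA) (mem_image_of_mem _ hu)

/-- The infimum of the energy on the radial `L^p` sphere is attained. -/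
lemma exists_minimizer (hs : 0 < s) (hs1 : s < 1) (hm : 0 < m) (hp2 : 2 < p)
    (hp : p < 6 / (3 - 2 * s)) (hA : Continuous A) (hiso : MagIsometryCondition A) :
    ∃ w ∈ radialSphere A s m p, magNormSq A s m w = radialInf A s m p := by
  have hp0 : 0 < p := by linarith
  have hne := radialSphere_nonempty (p := p) hs hs1 hm hA hp0
  set I := radialInf A s m p with hI
  have hI0 : 0 ≤ I := le_csInf (hne.image _) (by
    rintro _ ⟨u, hu, rfl⟩
    exact magNormSq_nonneg_of_mem hs hs1 hm hA hu.1)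
  obtain ⟨a, -, ha, haS⟩ := exists_seq_tendsto_sInf (hne.image (magNormSq A s m))
    (bddBelow_magNormSq hs hs1 hm hA)
  choose f hfS hfa using haS
  have hrep : ∀ n, ∃ U ∈ radSpace A s m, MagRepr A s m (f n) U := fun n =>
    (memHsARad_iff hs hs1 hm hA).1 (hfS n).1
  choose F hFrad hF using hrep
  have hnorm : Tendsto (fun n => ‖F n‖ ^ 2) atTop (𝓝 I) := by
    refine ha.congr fun n => ?_
    rw [← hfa, magNormSq_eq_norm_sq hs hs1 hm (hF n)]
  have hnorm' : Tendsto (fun n => ‖F n‖) atTop (𝓝 (√I)) :=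
    ((Real.continuous_sqrt.tendsto I).comp hnorm).congr fun n => Real.sqrt_sq (norm_nonneg _)
  obtain ⟨B, hB⟩ := hnorm'.bddAbove_range
  have hB : ∀ n, ‖F n‖ ≤ B := fun n => hB (mem_range_self n)
  obtain ⟨G, hG, ns, hns, hweak⟩ := exists_subseq_weak_tendsto (isClosed_radSpace hm) hFrad hB
  have hGr := magRepr_of_mem_HsASpace hm hG.1
  have hGrad : MemHsARad A s m (magFun s m G) := (memHsARad_iff hs hs1 hm hA).2 ⟨G, hG, hGr⟩
  -- Weak lower semicontinuity of the norm, obtained by testing weak convergence against the limit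
  -- `G` itself and applying Cauchy-Schwarz.
  have hGle : ‖G‖ ^ 2 ≤ I := by
    have h1 : Tendsto (fun n => ‖inner ℂ G (F (ns n))‖) atTop (𝓝 (‖G‖ ^ 2)) := by
      have := (hweak G).norm
      rwa [inner_self_eq_norm_sq_to_K, norm_pow, RCLike.norm_ofReal, abs_norm] at this
    have h2 : ‖G‖ ^ 2 ≤ ‖G‖ * √I := le_of_tendsto_of_tendsto' h1
      ((hnorm'.comp hns.tendsto_atTop).const_mul ‖G‖) fun n => norm_inner_le_norm _ _
    have h3 : ‖G‖ ^ 2 ≤ √I ^ 2 := by nlinarith [sq_nonneg (‖G‖ - √I)]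
    rwa [Real.sq_sqrt hI0] at h3
  have hcomp := tendsto_lintegral_rpow_of_weak hs hs1 hm hp2 hp hA hiso
    (f := fun n x => f (ns n) x - magFun s m G x) (F := fun n => F (ns n) - G)
    (fun n => (hF (ns n)).sub hGr) (fun n g => by
      filter_upwards [(hfS (ns n)).1.2 g, hGrad.2 g] with x h1 h2
      rw [h1, h2]) (T := B + ‖G‖)
    (fun n => (norm_sub_le _ _).trans (by gcongr; exact hB _))
    (fun W => by
      simp_rw [inner_sub_right]
      simpa using (hweak W).sub_const (inner ℂ W G))
  have hsmall : ∀ ε : ℝ, 0 < ε → ∃ n,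
      eLpNorm (f (ns n) - magFun s m G) (ENNReal.ofReal p) volume ≤ ENNReal.ofReal ε := by
    intro ε hε
    obtain ⟨n, hn⟩ := (hcomp (ε ^ p) (by positivity)).exists
    refine ⟨n, ?_⟩
    rw [eLpNorm_ofReal_eq hp0]
    calc (∫⁻ x, ‖f (ns n) x - magFun s m G x‖ₑ ^ p) ^ (1 / p)
        ≤ (ENNReal.ofReal (ε ^ p)) ^ (1 / p) := by gcongr
      _ = ENNReal.ofReal ε := by
        rw [ENNReal.ofReal_rpow_of_nonneg (by positivity) (by positivity), ← Real.rpow_mul hε.le,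
          mul_one_div_cancel hp0.ne', Real.rpow_one]
  have hp1 : (1 : ENNReal) ≤ ENNReal.ofReal p := by
    rw [← ENNReal.ofReal_one]; exact ENNReal.ofReal_le_ofReal (by linarith)
  have hfm : ∀ n, AEStronglyMeasurable (f n) := fun n => (hfS n).1.1.1.1.1
  have hGm : AEStronglyMeasurable (magFun s m G) := hGrad.1.1.1.1
  -- The constraint survives the limit, since `L^p` distances to norm-one functions become
  -- arbitrarily small along the subsequence.
  have hGp : eLpNorm (magFun s m G) (ENNReal.ofReal p) volume = 1 := by
    refine le_antisymm ?_ ?_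
    · refine ENNReal.le_of_forall_pos_le_add fun ε hε _ => ?_
      obtain ⟨n, hn⟩ := hsmall ε (by exact_mod_cast hε)
      have h1 : magFun s m G = f (ns n) - (f (ns n) - magFun s m G) := by abel
      conv_lhs => rw [h1]
      refine (eLpNorm_sub_le (hfm _) ((hfm _).sub hGm) hp1).trans ?_
      rw [(hfS (ns n)).2]
      gcongr
      simpa using hn
    · refine ENNReal.le_of_forall_pos_le_add fun ε hε _ => ?_
      obtain ⟨n, hn⟩ := hsmall ε (by exact_mod_cast hε)
      have h1 : f (ns n) = magFun s m G + (f (ns n) - magFun s m G) := by abel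
      rw [← (hfS (ns n)).2]
      conv_lhs => rw [h1]
      refine (eLpNorm_add_le hGm ((hfm _).sub hGm) hp1).trans ?_
      gcongr
      simpa using hn
  have hmem : magFun s m G ∈ radialSphere A s m p := ⟨hGrad, hGp⟩
  refine ⟨_, hmem, le_antisymm ?_ (radialInf_le hs hs1 hm hA hmem)⟩
  rw [magNormSq_eq_norm_sq hs hs1 hm hGr]
  exact hGle

lemma ae_ne_zero_of_mem_radialSphere (hu : u ∈ radialSphere A s m p) :
    ¬ u =ᵐ[volume] 0 := by
  intro h
  have h1 := hu.2
  rw [eLpNorm_congr_ae h, eLpNorm_zero] at h1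
  exact zero_ne_one h1

lemma magNormSq_pos_of_mem_radialSphere (hs : 0 < s) (hs1 : s < 1) (hm : 0 < m)
    (hA : Continuous A) (hu : u ∈ radialSphere A s m p) :
    0 < magNormSq A s m u := by
  obtain ⟨U, -, hU⟩ := (memHsARad_iff hs hs1 hm hA).1 hu.1
  rw [magNormSq_eq_norm_sq hs hs1 hm hU]
  have hU0 : U ≠ 0 := by
    rintro rfl
    refine ae_ne_zero_of_mem_radialSphere hu ?_
    exact (hU.ae_eq_magFun hm).symm.trans (magRepr_zero.ae_eq_magFun (A := A) hm)
  have := norm_pos_iff.2 hU0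
  positivity

/-! ### Euler-Lagrange equation in the radial class -/

/-- The supporting hyperplane inequality for `|·|^p`. -/
lemma norm_add_rpow_ge (hp : 2 < p) (a b : ℂ) :
    ‖a‖ ^ p + p * (((‖a‖ ^ (p - 2) : ℝ) : ℂ) * a * conj b).re ≤ ‖a + b‖ ^ p := by
  rcases eq_or_ne a 0 with rfl | ha
  · rw [norm_zero, Real.zero_rpow (by linarith)]
    simp only [mul_zero, zero_mul, Complex.zero_re, add_zero]
    positivity
  have ha0 : 0 < ‖a‖ := norm_pos_iff.2 ha
  have h1 : ‖a‖ ^ 2 + (a * conj b).re ≤ ‖a‖ * ‖a + b‖ := by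
    have h2 : (a * conj (a + b)).re ≤ ‖a‖ * ‖a + b‖ := by
      refine (Complex.re_le_norm _).trans ?_
      rw [norm_mul, Complex.norm_conj]
    rwa [map_add, mul_add, Complex.add_re, Complex.mul_conj, Complex.ofReal_re,
      Complex.normSq_eq_norm_sq] at h2
  -- Bernoulli's inequality at the ratio `‖a + b‖ / ‖a‖`. Combined with `h1`, the Cauchy-Schwarz
  -- bound for `a` and `a + b`, it gives the tangent-plane inequality without differentiating the
  -- norm.
  have h3 := one_add_mul_self_le_rpow_one_add (s := ‖a + b‖ / ‖a‖ - 1)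
    (by have : 0 ≤ ‖a + b‖ / ‖a‖ := by positivity
        linarith) (p := p) (by linarith)
  rw [add_sub_cancel, Real.div_rpow (norm_nonneg _) ha0.le, le_div_iff₀ (by positivity)] at h3
  refine le_trans ?_ h3
  have h4 : ‖a‖ ^ p = ‖a‖ ^ (p - 2) * ‖a‖ ^ 2 := by
    rw [← Real.rpow_natCast, ← Real.rpow_add ha0]; norm_num
  have h5 : 0 ≤ ‖a‖ ^ (p - 2) := by positivity
  have h6 : (‖a + b‖ / ‖a‖ - 1) * ‖a‖ ^ 2 = ‖a‖ * ‖a + b‖ - ‖a‖ ^ 2 := by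
    field_simp
  rw [mul_assoc, Complex.re_ofReal_mul, h4]
  have h7 : ‖a‖ ^ (p - 2) * (a * conj b).re ≤ ‖a‖ ^ (p - 2) * (‖a‖ * ‖a + b‖ - ‖a‖ ^ 2) := by
    gcongr; linarith
  rw [← h6] at h7
  have h8 : p * (‖a‖ ^ (p - 2) * (a * conj b).re)
      ≤ p * (‖a‖ ^ (p - 2) * ((‖a + b‖ / ‖a‖ - 1) * ‖a‖ ^ 2)) := by gcongr
  linarith

lemma aestronglyMeasurable_powerNonlin (hu : AEStronglyMeasurable u) :
    AEStronglyMeasurable (powerNonlin p u) := by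
  unfold powerNonlin
  exact (Complex.measurable_ofReal.comp_aemeasurable
    (hu.norm.aemeasurable.pow_const _)).aestronglyMeasurable.mul hu

/-- Replacing both factors by the larger of `‖u x‖` and `‖v x‖` gives a crude Young inequality. It
suffices for integrability and for boundedness of the functional. -/
lemma norm_powerNonlin_mul_le (hp : 2 < p) (x : E3) :
    ‖powerNonlin p u x‖ * ‖v x‖ ≤ ‖u x‖ ^ p + ‖v x‖ ^ p := by
  have h1 : ‖powerNonlin p u x‖ * ‖v x‖ = ‖u x‖ ^ (p - 2) * ‖u x‖ * ‖v x‖ := by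
    rw [powerNonlin, norm_mul, Complex.norm_real, Real.norm_of_nonneg (by positivity)]
  have key : ∀ a : ℝ, 0 ≤ a → a ^ (p - 2) * a * a = a ^ p := by
    intro a ha
    rcases ha.eq_or_lt with rfl | ha
    · rw [Real.zero_rpow (by linarith), Real.zero_rpow (by linarith)]; simp
    · have : a ^ p = a ^ (p - 2) * a ^ (2 : ℝ) := by rw [← Real.rpow_add ha]; ring_nf
      rw [this]; norm_cast; ring
  rw [h1]
  have hu0 := norm_nonneg (u x)
  have hv0 := norm_nonneg (v x)
  have hup : 0 ≤ ‖u x‖ ^ p := by positivity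
  have hvp : 0 ≤ ‖v x‖ ^ p := by positivity
  have hp' : 0 ≤ p - 2 := by linarith
  rcases le_total ‖u x‖ ‖v x‖ with h | h
  · calc ‖u x‖ ^ (p - 2) * ‖u x‖ * ‖v x‖ ≤ ‖v x‖ ^ (p - 2) * ‖v x‖ * ‖v x‖ := by gcongr
      _ = ‖v x‖ ^ p := key _ hv0
      _ ≤ _ := by linarith
  · calc ‖u x‖ ^ (p - 2) * ‖u x‖ * ‖v x‖ ≤ ‖u x‖ ^ (p - 2) * ‖u x‖ * ‖u x‖ := by gcongr
      _ = ‖u x‖ ^ p := key _ hu0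
      _ ≤ _ := by linarith

lemma integrable_norm_rpow_of_memLp (hp : 0 < p) (hu : MemLp u (ENNReal.ofReal p)) :
    Integrable fun x => ‖u x‖ ^ p := by
  have := hu.integrable_norm_rpow (by simpa using hp) ENNReal.ofReal_ne_top
  rwa [ENNReal.toReal_ofReal hp.le] at this

lemma integrable_powerNonlin_mul_conj (hp : 2 < p) (hu : MemLp u (ENNReal.ofReal p))
    (hv : MemLp v (ENNReal.ofReal p)) :
    Integrable fun x => powerNonlin p u x * conj (v x) := by
  refine ((integrable_norm_rpow_of_memLp (by linarith) hu).add
    (integrable_norm_rpow_of_memLp (by linarith) hv)).mono'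
    ((aestronglyMeasurable_powerNonlin hu.1).mul
      (Complex.continuous_conj.comp_aestronglyMeasurable hv.1)) (ae_of_all _ fun x => ?_)
  rw [norm_mul, Complex.norm_conj]
  exact norm_powerNonlin_mul_le hp x

lemma eLpNorm_ofReal_eq_integral (hp : 0 < p) (hu : MemLp u (ENNReal.ofReal p)) :
    eLpNorm u (ENNReal.ofReal p) volume = ENNReal.ofReal ((∫ x, ‖u x‖ ^ p) ^ (1 / p)) := by
  rw [hu.eLpNorm_eq_integral_rpow_norm (by simpa using hp) ENNReal.ofReal_ne_top,
    ENNReal.toReal_ofReal hp.le, one_div]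

lemma integral_norm_rpow_add_ge (hp : 2 < p) (hu : MemLp u (ENNReal.ofReal p))
    (hv : MemLp v (ENNReal.ofReal p)) :
    (∫ x, ‖u x‖ ^ p) + p * (∫ x, powerNonlin p u x * conj (v x)).re
      ≤ ∫ x, ‖u x + v x‖ ^ p := by
  have h1 := integrable_norm_rpow_of_memLp (by linarith) hu
  have h2 := integrable_norm_rpow_of_memLp (by linarith) (hu.add hv)
  have h3 := integrable_powerNonlin_mul_conj hp hu hv
  have h4 : (∫ x, powerNonlin p u x * conj (v x)).re
      = ∫ x, (powerNonlin p u x * conj (v x)).re := (integral_re h3).symm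
  have h3' : Integrable fun x => (powerNonlin p u x * conj (v x)).re := h3.re
  rw [h4, ← integral_const_mul, ← integral_add h1 (h3'.const_mul p)]
  exact integral_mono (h1.add (h3'.const_mul p)) h2 fun x => norm_add_rpow_ge hp (u x) (v x)

/-- The Euler-Lagrange equation of a minimizer, tested against radial functions. -/
lemma euler_lagrange_radial (hs : 0 < s) (hs1 : s < 1) (hm : 0 < m) (hp2 : 2 < p)
    (hp : p ≤ 6 / (3 - 2 * s)) (hA : Continuous A)
    (hw : w ∈ radialSphere A s m p) (hmin : magNormSq A s m w = radialInf A s m p)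
    {W Φ : MagSpace} (hW : MagRepr A s m w W) {φ : E3 → ℂ} (hφ : MemHsARad A s m φ)
    (hΦ : MagRepr A s m φ Φ) :
    (inner ℂ W Φ).re = radialInf A s m p * (∫ x, powerNonlin p w x * conj (φ x)).re := by
  have hp0 : 0 < p := by linarith
  set I := radialInf A s m p with hI
  set l := (∫ x, powerNonlin p w x * conj (φ x)).re with hl
  have hwp := hw.1.1.memLp_rpow hs hs1 hm hA hp2 hp
  have hφp := hφ.1.memLp_rpow hs hs1 hm hA hp2 hp
  have hI0 : 0 ≤ I := hmin ▸ magNormSq_nonneg_of_mem hs hs1 hm hA hw.1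
  have hWI : ‖W‖ ^ 2 = I := by rw [← magNormSq_eq_norm_sq hs hs1 hm hW, hmin]
  have hw1 : ∫ x, ‖w x‖ ^ p = 1 := by
    have h1 := eLpNorm_ofReal_eq_integral hp0 hwp
    have h0 : 0 ≤ ∫ x, ‖w x‖ ^ p := integral_nonneg fun x => by positivity
    rw [hw.2, eq_comm, ENNReal.ofReal_eq_one] at h1
    have h2 := congrArg (· ^ p) h1
    simpa only [← Real.rpow_mul h0, one_div_mul_cancel hp0.ne', Real.rpow_one,
      Real.one_rpow] using h2
  -- Convexity gives `∫ |w + tφ|^p ≥ 1 + p t l`. Normalizing `w + tφ` and using minimality yields an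
  -- inequality that is an equality at `t = 0`.
  have hineq : ∀ t : ℝ, 0 < 1 + p * (t * l) →
      I * (1 + p * (t * l)) ^ (2 / p) ≤ ‖W + (t : ℂ) • Φ‖ ^ 2 := by
    intro t ht
    have hr := hW.add (hΦ.smul (t : ℂ))
    have hrad : MemHsARad A s m (fun x => w x + (t : ℂ) * φ x) := by
      obtain ⟨W', hW', hWr'⟩ := (memHsARad_iff hs hs1 hm hA).1 hw.1
      obtain ⟨Φ', hΦ', hΦr'⟩ := (memHsARad_iff hs hs1 hm hA).1 hφ
      exact (memHsARad_iff hs hs1 hm hA).2 ⟨_, add_mem hW' (Submodule.smul_mem _ (t : ℂ) hΦ'),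
        hWr'.add (hΦr'.smul _)⟩
    have hge := integral_norm_rpow_add_ge hp2 hwp (hφp.const_mul (t : ℂ))
    have h2 : (∫ x, powerNonlin p w x * conj ((t : ℂ) * φ x)).re = t * l := by
      have : ∀ x, powerNonlin p w x * conj ((t : ℂ) * φ x)
          = (t : ℂ) * (powerNonlin p w x * conj (φ x)) := fun x => by
        rw [map_mul, Complex.conj_ofReal]; ring
      simp_rw [this]
      rw [integral_const_mul, Complex.re_ofReal_mul]
    rw [hw1, h2] at hge
    set P := ∫ x, ‖w x + (t : ℂ) * φ x‖ ^ p with hP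
    have hP0 : 0 < P := ht.trans_le hge
    have hnorm := eLpNorm_ofReal_eq_integral hp0
      (hrad.1.memLp_rpow hs hs1 hm hA hp2 hp)
    have hS := mem_radialSphere_normalize hs hs1 hm hA hrad (p := p) (N := P ^ (1 / p))
      (by positivity) hnorm
    have hle := radialInf_le hs hs1 hm hA hS
    rw [magNormSq_eq_norm_sq hs hs1 hm (hr.smul _), norm_smul, Complex.norm_real,
      Real.norm_of_nonneg (by positivity), mul_pow, inv_pow, ← div_eq_inv_mul,
      le_div_iff₀ (by positivity), ← Real.rpow_natCast, ← Real.rpow_mul hP0.le] at hle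
    refine le_trans ?_ hle
    gcongr ?_ * ?_
    calc (1 + p * (t * l)) ^ (2 / p) ≤ P ^ (2 / p) := by gcongr
      _ = _ := by congr 1; push_cast; ring
  have hexpand : ∀ t : ℝ, ‖W + (t : ℂ) • Φ‖ ^ 2
      = I + 2 * t * (inner ℂ W Φ).re + t ^ 2 * ‖Φ‖ ^ 2 := by
    intro t
    rw [@norm_add_sq ℂ, inner_smul_right, norm_smul, mul_pow, Complex.norm_real,
      Real.norm_eq_abs, sq_abs, hWI]
    simp only [RCLike.re_eq_complex_re, Complex.re_ofReal_mul]
    ring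
  -- The gap is nonnegative near `0` and vanishes there, so its derivative is zero. This needs only
  -- an explicit function of `t`, not a derivative of the `L^p` norm.
  set h : ℝ → ℝ := fun t => I + 2 * t * (inner ℂ W Φ).re + t ^ 2 * ‖Φ‖ ^ 2
    - I * (1 + p * (t * l)) ^ (2 / p) with hh
  have hmin' : IsLocalMin h 0 := by
    have hev : ∀ᶠ t : ℝ in 𝓝 0, 0 < 1 + p * (t * l) := by
      have : Tendsto (fun t : ℝ => 1 + p * (t * l)) (𝓝 0) (𝓝 (1 + p * (0 * l))) :=
        (by fun_prop : Continuous fun t : ℝ => 1 + p * (t * l)).tendsto 0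
      exact this.eventually_const_lt (by simp)
    filter_upwards [hev] with t ht
    have h0 : h 0 = 0 := by simp [hh]
    rw [h0]
    have := hineq t ht
    rw [hexpand] at this
    simp only [hh]
    linarith
  have hder : HasDerivAt h (2 * (inner ℂ W Φ).re - I * (p * l * (2 / p))) 0 := by
    have h1 : HasDerivAt (fun t : ℝ => 1 + p * (t * l)) (p * l) 0 := by
      simpa using (((hasDerivAt_id (0 : ℝ)).mul_const l).const_mul p).const_add 1
    have h2 := h1.rpow_const (p := 2 / p) (Or.inl (by simp))
    have h3 : HasDerivAt (fun t : ℝ => I + 2 * t * (inner ℂ W Φ).re + t ^ 2 * ‖Φ‖ ^ 2)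
        (2 * (inner ℂ W Φ).re) 0 := by
      have h4 := (((hasDerivAt_id (0 : ℝ)).const_mul 2).mul_const (inner ℂ W Φ).re).const_add I
      have h5 := ((hasDerivAt_id (0 : ℝ)).pow 2).mul_const (‖Φ‖ ^ 2)
      exact (h4.add h5).congr_deriv (by simp)
    exact (h3.sub (h2.const_mul I)).congr_deriv (by simp)
  have hzero := hmin'.hasDerivAt_eq_zero hder
  have hcancel : p * l * (2 / p) = 2 * l := by field_simp
  rw [hcancel] at hzero
  linarith

/-! ### Riesz representation and symmetric criticality -/

lemma memHsA_magFun (hs : 0 < s) (hs1 : s < 1) (hm : 0 < m) (hA : Continuous A) {U : MagSpace}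
    (hU : U ∈ HsASpace A s m) : MemHsA A s m (magFun s m U) :=
  (memHsA_iff hs hs1 hm hA).2 ⟨U, hU, magRepr_of_mem_HsASpace hm hU⟩

/-- The functional `v ↦ ∫ conj(|w|^(p-2) w) v` on `H^s_A`. -/
def powerFunctional (hs : 0 < s) (hs1 : s < 1) (hm : 0 < m) (hA : Continuous A) (hp2 : 2 < p)
    (hp : p ≤ 6 / (3 - 2 * s)) (hw : MemLp w (ENNReal.ofReal p)) :
    HsASpace A s m →ₗ[ℂ] ℂ where
  toFun V := conj (∫ x, powerNonlin p w x * conj (magFun s m (V : MagSpace) x))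
  map_add' U V := by
    have hU := (memHsA_magFun hs hs1 hm hA U.2).memLp_rpow hs hs1 hm hA hp2 hp
    have hV := (memHsA_magFun hs hs1 hm hA V.2).memLp_rpow hs hs1 hm hA hp2 hp
    rw [← map_add, ← integral_add (integrable_powerNonlin_mul_conj hp2 hw hU)
      (integrable_powerNonlin_mul_conj hp2 hw hV)]
    congr 1
    refine integral_congr_ae ?_
    have h := ((magRepr_of_mem_HsASpace hm U.2).add
      (magRepr_of_mem_HsASpace hm V.2)).ae_eq_magFun hm
    filter_upwards [h] with x hx
    rw [Submodule.coe_add, hx, map_add, mul_add]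
  map_smul' a U := by
    have h := ((magRepr_of_mem_HsASpace hm U.2).smul a).ae_eq_magFun hm
    rw [RingHom.id_apply, smul_eq_mul, ← Complex.conj_conj a, ← map_mul, ← integral_const_mul,
      Complex.conj_conj a]
    congr 1
    refine integral_congr_ae ?_
    filter_upwards [h] with x hx
    rw [Submodule.coe_smul, hx, map_mul]; ring

/-- On the unit ball, the crude Young inequality and the Sobolev inequality bound the functional by
a constant; linearity then gives the operator bound. The `/ 1` is the radius of that ball. -/
lemma exists_powerFunctional_bound (hs : 0 < s) (hs1 : s < 1) (hm : 0 < m) (hA : Continuous A)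
    (hp2 : 2 < p) (hp : p ≤ 6 / (3 - 2 * s)) (hw : MemLp w (ENNReal.ofReal p)) :
    ∃ C : ℝ, ∀ V : HsASpace A s m, ‖powerFunctional hs hs1 hm hA hp2 hp hw V‖ ≤ C * ‖V‖ := by
  have hp0 : 0 < p := by linarith
  obtain ⟨C, hC, hSob⟩ := exists_lintegral_rpow_le hs hs1 hm hp2 hp
  refine ⟨((∫ x, ‖w x‖ ^ p) + C) / 1, fun V => LinearMap.bound_of_ball_bound' one_pos _
    (powerFunctional hs hs1 hm hA hp2 hp hw) (fun V hV => ?_) V⟩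
  have hV1 : ‖(V : MagSpace)‖ ≤ 1 := by simpa using hV
  have hVp := (memHsA_magFun hs hs1 hm hA V.2).memLp_rpow hs hs1 hm hA hp2 hp
  have hVi := integrable_norm_rpow_of_memLp hp0 hVp
  have hint : ∫ x, ‖magFun s m (V : MagSpace) x‖ ^ p ≤ C := by
    have h1 := hSob A hA _ _ (magRepr_of_mem_HsASpace hm V.2)
    have h2 : ENNReal.ofReal (∫ x, ‖magFun s m (V : MagSpace) x‖ ^ p)
        = ∫⁻ x, ‖magFun s m (V : MagSpace) x‖ₑ ^ p := by
      rw [ofReal_integral_eq_lintegral_ofReal hVi (ae_of_all _ fun x => by positivity)]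
      refine lintegral_congr fun x => ?_
      rw [← ofReal_norm, ENNReal.ofReal_rpow_of_nonneg (norm_nonneg _) hp0.le]
    rw [← h2, ENNReal.ofReal_le_ofReal_iff (by positivity)] at h1
    refine h1.trans (mul_le_of_le_one_right hC.le ?_)
    exact Real.rpow_le_one (norm_nonneg _) hV1 hp0.le
  calc ‖powerFunctional hs hs1 hm hA hp2 hp hw V‖
      = ‖∫ x, powerNonlin p w x * conj (magFun s m (V : MagSpace) x)‖ := Complex.norm_conj _
    _ ≤ ∫ x, (‖w x‖ ^ p + ‖magFun s m (V : MagSpace) x‖ ^ p) := by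
        refine norm_integral_le_of_norm_le ((integrable_norm_rpow_of_memLp hp0 hw).add hVi)
          (ae_of_all _ fun x => ?_)
        rw [norm_mul, Complex.norm_conj]
        exact norm_powerNonlin_mul_le hp2 x
    _ = (∫ x, ‖w x‖ ^ p) + ∫ x, ‖magFun s m (V : MagSpace) x‖ ^ p :=
        integral_add (integrable_norm_rpow_of_memLp hp0 hw) hVi
    _ ≤ _ := by gcongr

/-- Riesz representation of `v ↦ ∫ conj(|w|^(p-2) w) v` on `H^s_A`. -/
lemma exists_riesz (hs : 0 < s) (hs1 : s < 1) (hm : 0 < m) (hA : Continuous A)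
    (hp2 : 2 < p) (hp : p ≤ 6 / (3 - 2 * s)) (hw : MemLp w (ENNReal.ofReal p)) :
    ∃ X ∈ HsASpace A s m, ∀ V ∈ HsASpace A s m, ∀ v : E3 → ℂ, MagRepr A s m v V →
      (inner ℂ X V).re = (∫ x, powerNonlin p w x * conj (v x)).re := by
  have : CompleteSpace (HsASpace A s m) := isClosed_HsASpace.completeSpace_coe
  obtain ⟨C, hC⟩ := exists_powerFunctional_bound hs hs1 hm hA hp2 hp hw
  set L := (powerFunctional hs hs1 hm hA hp2 hp hw).mkContinuous C hC
  set X := (InnerProductSpace.toDual ℂ (HsASpace A s m)).symm L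
  refine ⟨X, X.2, fun V hV v hv => ?_⟩
  have h1 : inner ℂ (X : MagSpace) V = L ⟨V, hV⟩ :=
    InnerProductSpace.toDual_symm_apply (x := (⟨V, hV⟩ : HsASpace A s m)) (y := L)
  have h2 : L ⟨V, hV⟩ = conj (∫ x, powerNonlin p w x * conj (magFun s m V x)) := rfl
  have h3 : ∫ x, powerNonlin p w x * conj (magFun s m V x)
      = ∫ x, powerNonlin p w x * conj (v x) := by
    refine integral_congr_ae ?_
    filter_upwards [hv.ae_eq_magFun hm] with x hx
    rw [hx]
  rw [h1, h2, h3, Complex.conj_re]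

lemma powerNonlin_comp_ae (hw : IsRadialAE w) (g : E3 ≃ₗᵢ[ℝ] E3) :
    (fun x => powerNonlin p w (g x)) =ᵐ[volume] powerNonlin p w := by
  filter_upwards [hw g] with x hx
  simp only [powerNonlin, hx]

/-- Symmetric criticality: for radial `w` the Riesz representative is radial. -/
lemma exists_riesz_radial (hs : 0 < s) (hs1 : s < 1) (hm : 0 < m) (hA : Continuous A)
    (hiso : MagIsometryCondition A) (hp2 : 2 < p) (hp : p ≤ 6 / (3 - 2 * s))
    (hw : MemLp w (ENNReal.ofReal p)) (hrad : IsRadialAE w) :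
    ∃ X ∈ radSpace A s m, ∀ V ∈ HsASpace A s m, ∀ v : E3 → ℂ, MagRepr A s m v V →
      (inner ℂ X V).re = (∫ x, powerNonlin p w x * conj (v x)).re := by
  obtain ⟨X, hX, hXV⟩ := exists_riesz hs hs1 hm hA hp2 hp hw
  refine ⟨X, ⟨hX, magFun s m X, magRepr_of_mem_HsASpace hm hX, fun g => ?_⟩, hXV⟩
  set ξ := magFun s m X
  have hξr := magRepr_of_mem_HsASpace hm hX
  have hξ : MemHsA A s m ξ := memHsA_magFun hs hs1 hm hA hX
  obtain ⟨Y, hY, hYr⟩ := (memHsA_iff hs hs1 hm hA).1 (memHsA_comp hiso g hξ)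
  -- Moving `g` onto the test function preserves the scalar product, and changing variables back
  -- preserves the functional because `w` is radial. So `ξ ∘ g` represents the same functional as
  -- `ξ`.
  have key : ∀ V ∈ HsASpace A s m, (inner ℂ Y V).re = (inner ℂ X V).re := by
    intro V hV
    have hVr := magRepr_of_mem_HsASpace hm hV
    have hv : MemHsA A s m (magFun s m V) := memHsA_magFun hs hs1 hm hA hV
    obtain ⟨V', hV', hVr'⟩ := (memHsA_iff hs hs1 hm hA).1 (memHsA_comp hiso g.symm hv)
    have h1 : magInner A s m (magFun s m V) (fun z => ξ (g z))
        = magInner A s m (fun z => magFun s m V (g.symm z)) ξ := by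
      rw [← magInner_comp hiso g (u := fun z => magFun s m V (g.symm z)) (v := ξ)]
      simp
    rw [← magInner_eq_re_inner hs hs1 hm hVr hYr, h1,
      magInner_eq_re_inner hs hs1 hm hVr' hξr, hXV V' hV' _ hVr', hXV V hV _ hVr,
      ← g.measurePreserving.integral_comp (measurableEmbedding_isometry g)]
    congr 1
    refine integral_congr_ae ?_
    filter_upwards [powerNonlin_comp_ae (p := p) hrad g] with x hx
    rw [hx, g.symm_apply_apply]
  have h0 : (inner ℂ (Y - X) (Y - X)).re = 0 := by
    rw [inner_sub_left, Complex.sub_re, key _ (sub_mem hY hX), sub_self]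
  rw [inner_self_eq_norm_sq_to_K] at h0
  have h0' : ‖Y - X‖ ^ 2 = 0 := by exact_mod_cast h0
  have hYX : Y = X := sub_eq_zero.1 (norm_eq_zero.1 (pow_eq_zero_iff two_ne_zero |>.1 h0'))
  rw [hYX] at hYr
  exact (hYr.ae_eq_magFun hm).symm

/-- The Euler-Lagrange equation of a minimizer on the radial sphere, tested against all of
`H^s_A`. -/
lemma euler_lagrange (hs : 0 < s) (hs1 : s < 1) (hm : 0 < m) (hp2 : 2 < p)
    (hp : p ≤ 6 / (3 - 2 * s)) (hA : Continuous A) (hiso : MagIsometryCondition A)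
    (hw : w ∈ radialSphere A s m p) (hmin : magNormSq A s m w = radialInf A s m p)
    (hv : MemHsA A s m v) :
    magInner A s m w v = radialInf A s m p * (∫ x, powerNonlin p w x * conj (v x)).re := by
  have hwp := hw.1.1.memLp_rpow hs hs1 hm hA hp2 hp
  obtain ⟨X, hX, hXV⟩ := exists_riesz_radial hs hs1 hm hA hiso hp2 hp hwp hw.1.2
  obtain ⟨W, hW, hWr⟩ := (memHsARad_iff hs hs1 hm hA).1 hw.1
  set I := radialInf A s m p with hI
  -- The residual of the full equation is itself radial, so it is admissible in the radial
  -- Euler-Lagrange equation. Testing with it gives `‖Φ‖² = 0`, hence `W = I X`.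
  set Φ := W - (I : ℂ) • X with hΦ
  have hΦrad : Φ ∈ radSpace A s m := sub_mem hW (Submodule.smul_mem _ _ hX)
  have hΦr := magRepr_of_mem_HsASpace hm hΦrad.1
  have hEL := euler_lagrange_radial hs hs1 hm hp2 hp hA hw hmin hWr
    ((memHsARad_iff hs hs1 hm hA).2 ⟨Φ, hΦrad, hΦr⟩) hΦr
  rw [← hXV Φ hΦrad.1 _ hΦr] at hEL
  have h0 : (inner ℂ Φ Φ).re = 0 := by
    conv_lhs => rw [hΦ, inner_sub_left, inner_smul_left, Complex.conj_ofReal, ← hΦ]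
    rw [Complex.sub_re, Complex.re_ofReal_mul, hEL, sub_self]
  rw [inner_self_eq_norm_sq_to_K] at h0
  have h0' : ‖Φ‖ ^ 2 = 0 := by exact_mod_cast h0
  have hWX : W = (I : ℂ) • X :=
    sub_eq_zero.1 (norm_eq_zero.1 (pow_eq_zero_iff two_ne_zero |>.1 h0'))
  obtain ⟨V, hV, hVr⟩ := (memHsA_iff hs hs1 hm hA).1 hv
  rw [magInner_eq_re_inner hs hs1 hm hWr hVr, ← hXV V hV v hVr, ← inner_conj_symm,
    Complex.conj_re, hWX, inner_smul_left, Complex.conj_ofReal, Complex.re_ofReal_mul]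

/-! ### Scaling the minimizer to a weak solution -/

lemma powerNonlin_const_mul {a : ℝ} (ha : 0 ≤ a) (x : E3) :
    powerNonlin p (fun z => (a : ℂ) * w z) x
      = ((a ^ (p - 2) * a : ℝ) : ℂ) * powerNonlin p w x := by
  simp only [powerNonlin]
  rw [norm_mul, Complex.norm_real, Real.norm_of_nonneg ha, Real.mul_rpow ha (norm_nonneg _)]
  push_cast
  ring

lemma magInner_const_mul_left (hs : 0 < s) (hs1 : s < 1) (hm : 0 < m) (hA : Continuous A)
    (hu : MemHsA A s m u) (hv : MemHsA A s m v) (a : ℝ) :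
    magInner A s m (fun x => (a : ℂ) * u x) v = a * magInner A s m u v := by
  obtain ⟨U, -, hU⟩ := (memHsA_iff hs hs1 hm hA).1 hu
  obtain ⟨V, -, hV⟩ := (memHsA_iff hs hs1 hm hA).1 hv
  rw [magInner_eq_re_inner hs hs1 hm (hU.smul a) hV, magInner_eq_re_inner hs hs1 hm hU hV,
    inner_smul_right, Complex.re_ofReal_mul]

end

theorem mainTheorem5 (s m p : ℝ) (hs0 : 0 < s) (hs1 : s < 1) (hm : 0 < m)
    (hp2 : 2 < p) (hp : p < 6 / (3 - 2 * s))
    (A : E3 → E3) (hA : LocallyLipschitz A) (hiso : MagIsometryCondition A) :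
    ∃ w u : E3 → ℂ,
      w ∈ radialSphere A s m p ∧
      (∀ v ∈ radialSphere A s m p, magNormSq A s m w ≤ magNormSq A s m v) ∧
      magNormSq A s m w = radialInf A s m p ∧
      0 < radialInf A s m p ∧
      u = (fun x => ((radialInf A s m p ^ (1 / (p - 2)) : ℝ) : ℂ) * w x) ∧
      MemHsARad A s m u ∧
      ¬ (u =ᵐ[MeasureTheory.volume] 0) ∧
      IsMagWeakSolution A s m (powerNonlin p u) u := by
  have hAc := hA.continuous
  obtain ⟨w, hw, hmin⟩ := exists_minimizer hs0 hs1 hm hp2 hp hAc hiso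
  have hI : 0 < radialInf A s m p :=
    hmin ▸ magNormSq_pos_of_mem_radialSphere hs0 hs1 hm hAc hw
  set I := radialInf A s m p with hIdef
  set a : ℝ := I ^ (1 / (p - 2)) with ha
  have ha0 : 0 < a := Real.rpow_pos_of_pos hI _
  -- This scaling removes the multiplier: with `u = a w` the nonlinearity becomes `a^(p-2) a = I a`
  -- times that of `w`, matching the Euler-Lagrange equation multiplied by `a`.
  have hap : a ^ (p - 2) = I := by
    rw [ha, ← Real.rpow_mul hI.le, one_div_mul_cancel (by linarith), Real.rpow_one]
  have hu := memHsARad_const_mul hs0 hs1 hm hAc hw.1 (a : ℂ)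
  refine ⟨w, _, hw, fun v hv => hmin ▸ radialInf_le hs0 hs1 hm hAc hv, hmin, hI, rfl, hu,
    fun h => ae_ne_zero_of_mem_radialSphere hw ?_, hu.1, fun v hv => ⟨?_, ?_⟩⟩
  · filter_upwards [h] with x hx
    exact (mul_eq_zero.1 hx).resolve_left (by exact_mod_cast ha0.ne')
  · exact integrable_powerNonlin_mul_conj hp2 (hu.1.memLp_rpow hs0 hs1 hm hAc hp2 hp.le)
      (hv.memLp_rpow hs0 hs1 hm hAc hp2 hp.le)
  · rw [magInner_const_mul_left hs0 hs1 hm hAc hw.1.1 hv,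
      euler_lagrange hs0 hs1 hm hp2 hp.le hAc hiso hw hmin hv]
    simp_rw [powerNonlin_const_mul ha0.le, hap, mul_assoc]
    rw [integral_const_mul, Complex.re_ofReal_mul]
    ring
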